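/- Let $m\ge 3$ be odd, let $\mathbb{F}_{3^m}$ be the field with $3^m$ elements, and let $\mathrm{Tr}$ denote the trace function from $\mathbb{F}_{3^m}$ to $\mathbb{F}_3$. Let $d$ be one of the following exponents: (i) $d=\frac{3^m+1}{4}+\frac{3^m-1}{2}$; (ii) $d=3^{\frac{m+1}{2}}-1$; (iii) $d=\left(3^{\frac{m+1}{4}}-1\right)\left(3^{\frac{m+1}{2}}+1\right)$, where $m\equiv 3 \pmod 4$. Then $x\mapsto x^d$ is an almost perfect nonlinear (APN) function over $\mathbb{F}_{3^m}$, that is, the maximum over all $a\ne 0$ and all $b$ in $\mathbb{F}_{3^m}$ of the number of solutions $x\in\mathbb{F}_{3^m}$ of $(x+a)^d-x^d=b$ is equal to $2$. Moreover, there is a positive integer $k$ such that, with $e=\gcd(k,m)$, the integer $\frac{m}{e}$ is odd and at least $3$, such that $$d\left(3^k+1\right)\equiv 2 \pmod{3^m-1},$$ and such that the following holds. The set $D(0)=\{x\in\mathbb{F}_{3^m}^*\mid \mathrm{Tr}(x^d)=0\}$ has $n=3^{m-1}-1$ elements, and for every enumeration $\beta_1,\dots,\beta_n$ of $D(0)$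 the code $$\mathcal{C}_{D(0)}=\left\{\left(\mathrm{Tr}(\beta_1x),\mathrm{Tr}(\beta_2x),\dots,\mathrm{Tr}(\beta_nx)\right)\mid x\in\mathbb{F}_{3^m}\right\}$$ is a $[3^{m-1}-1,m]$ linear code over $\mathbb{F}_3$ with exactly $1$ codeword of Hamming weight $0$, exactly $3^{m-e}+3^{\frac{m-e}{2}}$ codewords of weight $2\left(3^{m-2}-3^{\frac{m+e}{2}-2}\right)$, exactly $3^{m-e}-3^{\frac{m-e}{2}}$ codewords of weight $2\left(3^{m-2}+3^{\frac{m+e}{2}-2}\right)$, exactly $3^m-1-2\cdot 3^{m-e}$ codewords of weight $2\cdot 3^{m-2}$, and no codewords of any other weight. -/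

import Mathlib

/-- The number of solutions `x` of `f (x + a) - f x = b`. -/
noncomputable def differentialCount {F : Type*} [Field F] (f : F → F) (a b : F) : ℕ :=
  Set.ncard {x : F | f (x + a) - f x = b}

/-- `f` is almost perfect nonlinear: its differential uniformity, the maximum of
`differentialCount f a b` over all `a ≠ 0` and all `b`, is equal to `2`. -/
def IsAPN {F : Type*} [Field F] (f : F → F) : Prop :=
  (∀ a b : F, a ≠ 0 → differentialCount f a b ≤ 2) ∧
    ∃ a b : F, a ≠ 0 ∧ differentialCount f a b = 2

/-- The defining set `D(a) = {x ∈ F^* | Tr(x^d) = a}`, with `Tr` the trace of `F` over `K`. -/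
def definingSet (K : Type*) {F : Type*} [Field K] [Field F] [Algebra K F] (d : ℕ) (a : K) :
    Set F :=
  {x : F | x ≠ 0 ∧ Algebra.trace K F (x ^ d) = a}

/-- The linear code `{(Tr(β₁ x), …, Tr(βₙ x)) | x ∈ F}` of length `n` over `K`. -/
def traceCode (K : Type*) {F : Type*} [Field K] [Field F] [Algebra K F] {n : ℕ} (β : Fin n → F) :
    Submodule K (Fin n → K) where
  carrier := {c | ∃ x : F, c = fun i => Algebra.trace K F (β i * x)}
  add_mem' := by
    rintro _ _ ⟨x, rfl⟩ ⟨y, rfl⟩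
    exact ⟨x + y, by funext i; simp [mul_add]⟩
  zero_mem' := ⟨0, by funext i; simp⟩
  smul_mem' := by
    rintro r _ ⟨x, rfl⟩
    exact ⟨r • x, by funext i; simp⟩

/-- The number of codewords of Hamming weight `w` in the code `C`. -/
noncomputable def weightCount {K : Type*} [Field K] [DecidableEq K] {n : ℕ}
    (C : Submodule K (Fin n → K)) (w : ℕ) : ℕ :=
  Set.ncard {c : Fin n → K | c ∈ C ∧ hammingNorm c = w}

/-- The three-weight distribution with parameters `m` and `e`: the number of codewords of
weight `w`. -/
def threeWeightFrequency (m e w : ℕ) : ℕ :=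
  if w = 0 then 1
  else if w = 2 * (3 ^ (m - 2) - 3 ^ ((m + e) / 2 - 2)) then 3 ^ (m - e) + 3 ^ ((m - e) / 2)
  else if w = 2 * (3 ^ (m - 2) + 3 ^ ((m + e) / 2 - 2)) then 3 ^ (m - e) - 3 ^ ((m - e) / 2)
  else if w = 2 * 3 ^ (m - 2) then 3 ^ m - 1 - 2 * 3 ^ (m - e)
  else 0

/-! Each exponent satisfies `d * (3 ^ k + 1) = 3 ^ (m + 1) - 1` for some `k` prime to `m`, so `e =
1` throughout. With `σ` the `k`-th power of Frobenius, `N x = x * σ x` and `f x = x ^ d`, this says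
that `f ∘ N` and `N ∘ f` are both squaring. As `m` is odd, `-1` is a nonsquare and every element is
`±N y`. `IsSquaringPair` records all that is needed.

APN: write `x + 1 = ε * N y` and `x = η * N z`. Then `f (x + 1) - f x = b` reads `y² - z² = b`,
while `ε * N y - η * N z = 1`. In the coordinates `y - z`, `y + z` these fix the product and, up to
sign, the sum of two quantities, so for `b ≠ 0` each of the cases `η = ε`, `η = -ε` has at most one
solution. A solution of the first kind produces one of the second, so 2 is attained.

Weights: substituting `b = ±N y` turns `Tr (f b) + Tr (b * x)` into a quadratic form in `y`
(`sum_even_eq_sum_norm`). Its radical has at most 9 elements, and the radicals for `x` and `-x` are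
not both nontrivial, so the weight takes at most three values for `x ≠ 0`
(`sum_charTrace_add_cases`). The first two moments then give the frequencies. -/

open scoped ComplexConjugate

/-! ### Characters of the prime field. -/

/-- The trace `ψ t + ψ (-t)` of a nontrivial additive character `ψ` of `ZMod 3`. -/
def charTrace (t : ZMod 3) : ℤ := if t = 0 then 2 else -1

theorem charTrace_mul (s t : ZMod 3) :
    charTrace s * charTrace t = charTrace (s + t) + charTrace (s - t) := by
  revert s t; decide

theorem three_mul_indicator_eq (t : ZMod 3) :
    (3 : ℤ) * (if t = 0 then 1 else 0) = 1 + charTrace t := by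
  revert t; decide

theorem nine_mul_indicator_eq (s t : ZMod 3) :
    (9 : ℤ) * (if s = 0 ∧ t = 0 then 1 else 0) =
      1 + charTrace s + charTrace t + charTrace (s + t) + charTrace (s - t) := by
  revert s t; decide

theorem stdAddChar_three_one_add_two :
    ZMod.stdAddChar (1 : ZMod 3) + ZMod.stdAddChar (2 : ZMod 3) = (-1 : ℂ) := by
  have h : ∑ t : ZMod 3, ZMod.stdAddChar t = (0 : ℂ) :=
    AddChar.sum_eq_zero_of_ne_one fun h => by
      have := ZMod.injective_stdAddChar (N := 3) (a₁ := 1) (a₂ := 0) (by rw [h]; rfl)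
      exact absurd this (by decide)
  have h3 : ∑ t : ZMod 3, ZMod.stdAddChar t = (ZMod.stdAddChar (0 : ZMod 3) : ℂ) +
    ZMod.stdAddChar (1 : ZMod 3) + ZMod.stdAddChar (2 : ZMod 3) := Fin.sum_univ_three _
  rw [h3, AddChar.map_zero_eq_one] at h
  linear_combination h

theorem stdAddChar_three_one_mul_two :
    ZMod.stdAddChar (1 : ZMod 3) * ZMod.stdAddChar (2 : ZMod 3) = (1 : ℂ) := by
  rw [← AddChar.map_add_eq_mul, show (1 : ZMod 3) + 2 = 0 by decide, AddChar.map_zero_eq_one]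

theorem charTrace_eq_stdAddChar (t : ZMod 3) :
    (charTrace t : ℂ) = ZMod.stdAddChar t + ZMod.stdAddChar (-t) := by
  have h := stdAddChar_three_one_add_two
  obtain rfl | rfl | rfl : t = 0 ∨ t = 1 ∨ t = 2 := by revert t; decide
  · norm_num [charTrace]
  · rw [show (-1 : ZMod 3) = 2 by decide, h]; simp [charTrace]
  · rw [show (-2 : ZMod 3) = 1 by decide, add_comm, h, charTrace, if_neg (by decide)]; simp

theorem charTrace_eq_two_mul_re (t : ZMod 3) :
    (charTrace t : ℝ) = 2 * (ZMod.stdAddChar t : ℂ).re := by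
  have h := congrArg Complex.re (charTrace_eq_stdAddChar t)
  rw [AddChar.map_neg_eq_conj] at h
  simp at h
  linarith

/-- For `w ≠ 0` this is the Gauss sum `±√-3`; squaring removes the sign, which depends on `w`. -/
theorem sq_sum_stdAddChar_mul_sq (w : ZMod 3) :
    (∑ t : ZMod 3, (ZMod.stdAddChar (w * (t * t)) : ℂ)) ^ 2 = if w = 0 then 9 else -3 := by
  have h := stdAddChar_three_one_add_two
  have h' := stdAddChar_three_one_mul_two
  have h3 : ∑ t : ZMod 3, (ZMod.stdAddChar (w * (t * t)) : ℂ) =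
      ZMod.stdAddChar (w * (0 * 0)) + ZMod.stdAddChar (w * (1 * 1)) +
        ZMod.stdAddChar (w * (2 * 2)) := Fin.sum_univ_three _
  rw [h3, show (2 : ZMod 3) * 2 = 1 by decide]
  obtain rfl | rfl | rfl : w = 0 ∨ w = 1 ∨ w = 2 := by clear h3; revert w; decide
  · norm_num
  · simp only [mul_one, mul_zero, AddChar.map_zero_eq_one]
    rw [if_neg (by decide)]
    linear_combination (4 * ZMod.stdAddChar (1 : ZMod 3)) * h - 4 * h'
  · simp only [mul_one, mul_zero, AddChar.map_zero_eq_one]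
    rw [if_neg (by decide)]
    linear_combination (4 * ZMod.stdAddChar (2 : ZMod 3)) * h - 4 * h'

theorem addChar_map_sum {A M ι : Type*} [AddCommMonoid A] [CommMonoid M] (ψ : AddChar A M)
    (s : Finset ι) (f : ι → A) : ψ (∑ i ∈ s, f i) = ∏ i ∈ s, ψ (f i) := by
  classical
  induction s using Finset.induction_on with
  | empty => simp
  | insert i s hi ih => rw [Finset.sum_insert hi, Finset.prod_insert hi, ψ.map_add_eq_mul, ih]

/-! ### Exponential sums of quadratic forms over the prime field. -/

section Quadratic

variable {V : Type*} [AddCommGroup V] [Module (ZMod 3) V] [Fintype V]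

/-- Diagonalising the form factors the sum into one-variable Gauss sums; `c` counts the zero
coefficients. -/
theorem exists_sq_sum_stdAddChar_quadraticForm (Q : QuadraticForm (ZMod 3) V) :
    ∃ r c : ℕ, r + c = Module.finrank (ZMod 3) V ∧
      (∑ v, (ZMod.stdAddChar (Q v) : ℂ)) ^ 2 = 9 ^ c * (-3) ^ r := by
  classical
  have : Invertible (2 : ZMod 3) := ⟨2, by decide, by decide⟩
  obtain ⟨w, ⟨e⟩⟩ := Q.equivalent_weightedSumSquares
  refine ⟨(Finset.univ.filter fun i => ¬ w i = 0).card, (Finset.univ.filter fun i => w i = 0).card,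
    ?_, ?_⟩
  · rw [add_comm, Finset.card_filter_add_card_filter_not]; simp
  · have h1 : ∑ v, (ZMod.stdAddChar (Q v) : ℂ) =
        ∑ x : Fin (Module.finrank (ZMod 3) V) → ZMod 3,
          ∏ i, ZMod.stdAddChar (w i * (x i * x i)) := by
      refine Fintype.sum_equiv e.toEquiv _ _ fun v => ?_
      rw [← e.map_app v, QuadraticMap.weightedSumSquares_apply, addChar_map_sum]
      rfl
    rw [h1, ← Fintype.piFinset_univ,
      Finset.sum_prod_piFinset Finset.univ (fun i t => (ZMod.stdAddChar (w i * (t * t)) : ℂ)),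
      ← Finset.prod_pow]
    simp_rw [sq_sum_stdAddChar_mul_sq]
    rw [Finset.prod_ite, Finset.prod_const, Finset.prod_const]

/-- Shifting `y` by `z` leaves `Q y + polar Q y z`. The sum over `z` is a sum of an additive
character, which vanishes unless `y` lies in the radical, and there `2 * Q y = 0` forces `Q y = 0`.
-/
theorem sum_stdAddChar_mul_conj (Q : QuadraticForm (ZMod 3) V) :
    (∑ v, (ZMod.stdAddChar (Q v) : ℂ)) * conj (∑ v, (ZMod.stdAddChar (Q v) : ℂ)) =
      Fintype.card V * (Set.ncard {y : V | ∀ z, QuadraticMap.polar Q y z = 0} : ℂ) := by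
  classical
  set ψ : AddChar (ZMod 3) ℂ := ZMod.stdAddChar
  have h1 : (∑ v, ψ (Q v)) * conj (∑ v, ψ (Q v)) = ∑ z, ∑ y, ψ (Q y) * ψ (-Q z) := by
    rw [map_sum, Finset.sum_mul_sum, Finset.sum_comm]
    simp_rw [AddChar.map_neg_eq_conj]
  have h2 : ∀ z, ∑ y, ψ (Q y) * ψ (-Q z) = ∑ y, ψ (Q y) * ψ (QuadraticMap.polar Q y z) := by
    intro z
    rw [← Equiv.sum_comp (Equiv.addRight z)]
    refine Finset.sum_congr rfl fun y _ => ?_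
    rw [← AddChar.map_add_eq_mul, ← AddChar.map_add_eq_mul]
    congr 1
    simp only [QuadraticMap.polar, Equiv.coe_addRight]
    ring
  have h3 : ∀ y, ∑ z, ψ (Q y) * ψ (QuadraticMap.polar Q y z) =
      if ∀ z, QuadraticMap.polar Q y z = 0 then (Fintype.card V : ℂ) else 0 := by
    intro y
    rw [← Finset.mul_sum]
    have h := AddChar.sum_eq_ite (R := ℂ)
      (ψ.compAddMonoidHom (QuadraticMap.polarBilin Q y).toAddMonoidHom)
    simp only [AddChar.compAddMonoidHom_apply] at h
    change ∑ z, ψ (QuadraticMap.polar Q y z) = _ at h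
    rw [h]
    have hiff : (ψ.compAddMonoidHom (QuadraticMap.polarBilin Q y).toAddMonoidHom = 0) ↔
        ∀ z, QuadraticMap.polar Q y z = 0 := by
      rw [AddChar.ext_iff]
      refine forall_congr' fun z => ?_
      change ψ (QuadraticMap.polar Q y z) = 1 ↔ _
      rw [← AddChar.map_zero_eq_one ψ]
      exact ZMod.injective_stdAddChar.eq_iff
    by_cases hy : ∀ z, QuadraticMap.polar Q y z = 0
    · rw [if_pos (hiff.2 hy), if_pos hy]
      have h4 := hy y
      rw [QuadraticMap.polar_self] at h4
      have h5 : Q y = 0 := by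
        generalize Q y = t at h4 ⊢
        revert t; decide
      rw [h5, AddChar.map_zero_eq_one, one_mul]
    · rw [if_neg (mt hiff.1 hy), if_neg hy, mul_zero]
  rw [h1]
  simp_rw [h2]
  rw [Finset.sum_comm]
  simp_rw [h3]
  rw [← Finset.sum_filter, Finset.sum_const, nsmul_eq_mul, mul_comm, Set.ncard_eq_toFinset_card']
  simp

/-- A quadratic form over `ZMod 3` in dimension `n` has a radical of cardinality `3 ^ c`; the
associated real exponential sum vanishes when the rank `n - c` is odd, and is
`± 2 * 3 ^ ((n + c) / 2)` when it is even. -/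
theorem exists_card_radical_and_sum_charTrace (Q : QuadraticForm (ZMod 3) V) :
    ∃ r c : ℕ, r + c = Module.finrank (ZMod 3) V ∧
      Set.ncard {y : V | ∀ z, QuadraticMap.polar Q y z = 0} = 3 ^ c ∧
      (Odd r → ∑ v, charTrace (Q v) = 0) ∧
      (∀ s, r = 2 * s → ∑ v, charTrace (Q v) = 2 * 3 ^ (c + s) ∨
        ∑ v, charTrace (Q v) = -(2 * 3 ^ (c + s))) := by
  obtain ⟨r, c, hrc, hS⟩ := exists_sq_sum_stdAddChar_quadraticForm Q
  have hconj := sum_stdAddChar_mul_conj Q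
  have hre : ((∑ v, charTrace (Q v) : ℤ) : ℝ) = 2 * (∑ v, (ZMod.stdAddChar (Q v) : ℂ)).re := by
    push_cast
    rw [Complex.re_sum, Finset.mul_sum]
    exact Finset.sum_congr rfl fun v _ => charTrace_eq_two_mul_re _
  set S : ℂ := ∑ v, (ZMod.stdAddChar (Q v) : ℂ)
  refine ⟨r, c, hrc, ?_, ?_, ?_⟩
  -- Comparing the two evaluations of `‖S‖ ^ 2` identifies the `c` of the diagonalisation with the
  -- dimension of the radical.
  · have hn : ‖S‖ ^ 2 = 9 ^ c * 3 ^ r := by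
      rw [← norm_pow, hS]; simp
    rw [Complex.mul_conj, Complex.normSq_eq_norm_sq, hn,
      Module.card_eq_pow_finrank (K := ZMod 3) (V := V), ← hrc, ZMod.card] at hconj
    have h : 9 ^ c * 3 ^ r =
        3 ^ (r + c) * Set.ncard {y : V | ∀ z, QuadraticMap.polar Q y z = 0} := by
      exact_mod_cast hconj
    have h' : 9 ^ c * 3 ^ r = 3 ^ (r + c) * 3 ^ c := by
      rw [show 9 = 3 ^ 2 by norm_num, ← pow_mul]; ring
    exact Nat.eq_of_mul_eq_mul_left (by positivity) (h.symm.trans h')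
  · intro hr
    -- A negative square makes `S` purely imaginary, and the integer sum is twice its real part.
    have h : S ^ 2 = ((-(9 ^ c * 3 ^ r) : ℝ) : ℂ) := by
      rw [hS, hr.neg_pow]; push_cast; ring
    have h1 := congrArg Complex.re h
    have h2 := congrArg Complex.im h
    rw [Complex.ofReal_re, sq, Complex.mul_re] at h1
    rw [Complex.ofReal_im, sq, Complex.mul_im] at h2
    have hpos : (0 : ℝ) < 9 ^ c * 3 ^ r := by positivity
    have h0 : S.re = 0 := by
      by_contra hne
      have him : S.im = 0 := by
        have : S.re * S.im = 0 := by linarith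
        exact (mul_eq_zero.1 this).resolve_left hne
      rw [him] at h1
      nlinarith [mul_self_nonneg S.re]
    rw [h0, mul_zero] at hre
    exact_mod_cast hre
  · rintro s rfl
    have h : S ^ 2 = ((3 : ℂ) ^ (c + s)) ^ 2 := by
      rw [hS, show (9 : ℂ) = 3 ^ 2 by norm_num, ← pow_mul, pow_mul (-3 : ℂ),
        show (-3 : ℂ) ^ 2 = 3 ^ 2 by norm_num, ← pow_mul]; ring
    have h3 : ((3 : ℂ) ^ (c + s)) = ((3 ^ (c + s) : ℝ) : ℂ) := by push_cast; rfl
    rcases sq_eq_sq_iff_eq_or_eq_neg.1 h with h | h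
    · left
      rw [h, h3, Complex.ofReal_re] at hre
      exact_mod_cast hre
    · right
      rw [h, h3, Complex.neg_re, Complex.ofReal_re, mul_neg] at hre
      exact_mod_cast hre

end Quadratic

/-! ### Squaring pairs and the APN property. -/

/-- The multiplicative map `f` is inverse to `x ↦ x * σ x` up to squaring, over a field in which
`-1` is not a square and in which the fixed field of `σ` is the prime field. -/
structure IsSquaringPair {F : Type*} [Field F] [Algebra (ZMod 3) F] (σ : F ≃ₐ[ZMod 3] F)
    (f : F → F) : Prop where
  fixed : ∀ x, σ x = x → x = 0 ∨ x = 1 ∨ x = -1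
  not_isSquare : ¬ IsSquare (-1 : F)
  isSquare_or : ∀ x : F, IsSquare x ∨ IsSquare (-x)
  map_mul : ∀ x y, f (x * y) = f x * f y
  map_neg : ∀ x, f (-x) = f x
  map_norm : ∀ x, f (x * σ x) = x ^ 2
  norm_map : ∀ x, f x * σ (f x) = x ^ 2

namespace IsSquaringPair

section Basic

variable {F : Type*} [Field F] [Algebra (ZMod 3) F]

theorem three_eq_zero : (3 : F) = 0 := by
  rw [← map_ofNat (algebraMap (ZMod 3) F) 3]
  exact (congrArg _ (by decide : (3 : ZMod 3) = 0)).trans (_root_.map_zero _)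

variable {σ : F ≃ₐ[ZMod 3] F} {f : F → F} (H : IsSquaringPair σ f)
include H

/-- The square of `x` is fixed by `σ`, hence is 0, 1 or -1. The value 1 would make `x = ±1` fixed,
and -1 is not a square. -/
theorem eq_zero_of_map_eq_neg {x : F} (hx : σ x = -x) : x = 0 := by
  have h : σ (x * x) = x * x := by rw [_root_.map_mul, hx]; ring
  rcases H.fixed _ h with h | h | h
  · exact mul_self_eq_zero.1 h
  · have hx' : σ x = x := by
      rcases mul_self_eq_one_iff.1 h with rfl | rfl <;> simp
    rw [hx'] at hx
    linear_combination x * three_eq_zero (F := F) - hx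
  · exact absurd ⟨x, h.symm⟩ H.not_isSquare

theorem eq_or_eq_neg_of_map_mul {κ u v : F} (hκ : κ = 1 ∨ κ = -1) (hu : u ≠ 0) (hv : v ≠ 0)
    (h : κ * σ v * u = σ u * v) : v = u ∨ v = -u := by
  have hσu : σ u ≠ 0 := (_root_.map_ne_zero σ).2 hu
  have hr : κ * σ (v / u) = v / u := by
    rw [map_div₀]
    field_simp
    linear_combination h
  rcases hκ with rfl | rfl
  · rcases H.fixed _ (by rwa [one_mul] at hr) with h | h | h
    · exact absurd h (div_ne_zero hv hu)
    · exact Or.inl ((div_eq_one_iff_eq hu).1 h)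
    · exact Or.inr (by rw [div_eq_iff hu] at h; rw [h]; ring)
  · exact absurd (H.eq_zero_of_map_eq_neg (by linear_combination -hr)) (div_ne_zero hv hu)

theorem map_sign {ε : F} (hε : ε = 1 ∨ ε = -1) (x : F) : f (ε * x) = f x := by
  rcases hε with rfl | rfl
  · rw [one_mul]
  · rw [neg_one_mul, H.map_neg]

theorem sq_eq_sq_of_norm {ε x y : F} (hε : ε = 1 ∨ ε = -1) (h : ε * (x * σ x) = y * σ y) :
    x ^ 2 = y ^ 2 := by
  rw [← H.map_norm x, ← H.map_norm y, ← h, H.map_sign hε]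

theorem exists_sign_mul_norm (x : F) :
    ∃ ε y : F, (ε = 1 ∨ ε = -1) ∧ x = ε * (y * σ y) := by
  rcases H.isSquare_or x with ⟨c, hc⟩ | ⟨c, hc⟩
  · exact ⟨1, f c, Or.inl rfl, by rw [H.norm_map, hc]; ring⟩
  · exact ⟨-1, f c, Or.inr rfl, by rw [H.norm_map]; linear_combination -hc⟩

omit H in
theorem norm_eq_norm_of_sq {x y : F} (h : x ^ 2 = y ^ 2) : x * σ x = y * σ y := by
  rcases sq_eq_sq_iff_eq_or_eq_neg.1 h with rfl | rfl
  · rfl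
  · rw [_root_.map_neg, neg_mul_neg]

omit H [Algebra (ZMod 3) F] in
/-- Two monic quadratics with opposite or equal linear coefficients and equal constant
coefficient have the same roots up to sign. -/
theorem sign_mul_eq_or {κ p q p' q' : F} (hκ : κ = 1 ∨ κ = -1) (hs : p' + q' = κ * (p + q))
    (hp : p' * q' = p * q) : κ * p' = p ∨ κ * p' = q := by
  have hκ2 : κ * κ = 1 := by rcases hκ with rfl | rfl <;> ring
  have h : (κ * p' - p) * (κ * p' - q) = 0 := by
    linear_combination p' ^ 2 * hκ2 + p' * hs - hp
  rcases mul_eq_zero.1 h with h | h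
  · exact Or.inl (sub_eq_zero.1 h)
  · exact Or.inr (sub_eq_zero.1 h)

omit H in
theorem sq_eq_of_sub_add {y z y' z' : F}
    (h : (y' - z' = y - z ∧ y' + z' = y + z) ∨ (y' - z' = -(y - z) ∧ y' + z' = -(y + z)) ∨
      (y' - z' = y + z ∧ y' + z' = y - z) ∨ (y' - z' = -(y + z) ∧ y' + z' = -(y - z))) :
    y' ^ 2 = y ^ 2 ∧ z' ^ 2 = z ^ 2 := by
  have h3 := three_eq_zero (F := F)
  rcases h with ⟨h1, h2⟩ | ⟨h1, h2⟩ | ⟨h1, h2⟩ | ⟨h1, h2⟩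
  · have hy : y' = y := by linear_combination (y' - y) * h3 - h1 - h2
    have hz : z' = z := by linear_combination (z' - z) * h3 + h1 - h2
    rw [hy, hz]; exact ⟨rfl, rfl⟩
  · have hy : y' = -y := by linear_combination (y' + y) * h3 - h1 - h2
    have hz : z' = -z := by linear_combination (z' + z) * h3 + h1 - h2
    rw [hy, hz, neg_sq, neg_sq]; exact ⟨rfl, rfl⟩
  · have hy : y' = y := by linear_combination (y' - y) * h3 - h1 - h2
    have hz : z' = -z := by linear_combination (z' + z) * h3 + h1 - h2
    rw [hy, hz, neg_sq]; exact ⟨rfl, rfl⟩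
  · have hy : y' = -y := by linear_combination (y' + y) * h3 - h1 - h2
    have hz : z' = z := by linear_combination (z' - z) * h3 + h1 - h2
    rw [hy, hz, neg_sq]; exact ⟨rfl, rfl⟩

omit H in
theorem sub_add_cases {y z y' z' : F} (hb : y ^ 2 - z ^ 2 ≠ 0)
    (hbb : y' ^ 2 - z' ^ 2 = y ^ 2 - z ^ 2)
    (h : (y' - z' = y - z ∨ y' - z' = -(y - z)) ∨ (y' - z' = y + z ∨ y' - z' = -(y + z))) :
    y' ^ 2 = y ^ 2 ∧ z' ^ 2 = z ^ 2 := by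
  have hu : y - z ≠ 0 := fun h => hb (by linear_combination (y + z) * h)
  have hw : y + z ≠ 0 := fun h => hb (by linear_combination (y - z) * h)
  apply sq_eq_of_sub_add
  rcases h with (h | h) | (h | h)
  · exact Or.inl ⟨h, mul_left_cancel₀ hu (by linear_combination hbb - (y' + z') * h)⟩
  · exact Or.inr (Or.inl ⟨h, mul_left_cancel₀ hu (by linear_combination -hbb + (y' + z') * h)⟩)
  · exact Or.inr (Or.inr (Or.inl
      ⟨h, mul_left_cancel₀ hw (by linear_combination hbb - (y' + z') * h)⟩))
  · exact Or.inr (Or.inr (Or.inr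
      ⟨h, mul_left_cancel₀ hw (by linear_combination -hbb + (y' + z') * h)⟩))

/-- With `u = y - z` and `w = y + z`, the elements `σ u * w` and `u * σ w` have sum `2 * (N y - N
z)` and product `b * σ b`, where `b = u * w`. They are thus known up to `κ` and order, and dividing
out `b` leaves `u' = ±u` or `u' = ±w`. -/
theorem sq_eq_of_norm_sub {κ y z y' z' : F} (hκ : κ = 1 ∨ κ = -1) (hb : y ^ 2 - z ^ 2 ≠ 0)
    (hbb : y' ^ 2 - z' ^ 2 = y ^ 2 - z ^ 2)
    (h : y' * σ y' - z' * σ z' = κ * (y * σ y - z * σ z)) :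
    y' ^ 2 = y ^ 2 ∧ z' ^ 2 = z ^ 2 := by
  have hb' : y' ^ 2 - z' ^ 2 ≠ 0 := by rwa [hbb]
  have hu : y - z ≠ 0 := fun h => hb (by linear_combination (y + z) * h)
  have hw : y + z ≠ 0 := fun h => hb (by linear_combination (y - z) * h)
  have hu' : y' - z' ≠ 0 := fun h => hb' (by linear_combination (y' + z') * h)
  have hσ := congrArg σ hbb
  simp only [map_sub, map_pow] at hσ
  refine sub_add_cases hb hbb ?_
  rcases sign_mul_eq_or (κ := κ) (p := σ (y - z) * (y + z)) (q := (y - z) * σ (y + z))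
    (p' := σ (y' - z') * (y' + z')) (q' := (y' - z') * σ (y' + z')) hκ
    (by simp only [map_sub, map_add]; linear_combination 2 * h)
    (by simp only [map_sub, map_add]
        linear_combination (σ y' ^ 2 - σ z' ^ 2) * hbb + (y ^ 2 - z ^ 2) * hσ) with h1 | h1
  · left
    refine H.eq_or_eq_neg_of_map_mul hκ hu hu' (mul_right_cancel₀ hb ?_)
    linear_combination (y - z) * (y' - z') * h1 - κ * σ (y' - z') * (y - z) * hbb
  · right
    refine H.eq_or_eq_neg_of_map_mul hκ hw hu' (mul_right_cancel₀ hb ?_)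
    linear_combination (y + z) * (y' - z') * h1 - κ * σ (y' - z') * (y + z) * hbb

/-- Here the two quantities are `N u` and `N w`, with sum `2 * (N y + N z)` and product `b * σ b`; a
norm determines its argument up to sign, even when known only up to `κ`. -/
theorem sq_eq_of_norm_add {κ y z y' z' : F} (hκ : κ = 1 ∨ κ = -1) (hb : y ^ 2 - z ^ 2 ≠ 0)
    (hbb : y' ^ 2 - z' ^ 2 = y ^ 2 - z ^ 2)
    (h : y' * σ y' + z' * σ z' = κ * (y * σ y + z * σ z)) :
    y' ^ 2 = y ^ 2 ∧ z' ^ 2 = z ^ 2 := by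
  have hσ := congrArg σ hbb
  simp only [map_sub, map_pow] at hσ
  refine sub_add_cases hb hbb ?_
  rcases sign_mul_eq_or (κ := κ) (p := (y - z) * σ (y - z)) (q := (y + z) * σ (y + z))
    (p' := (y' - z') * σ (y' - z')) (q' := (y' + z') * σ (y' + z')) hκ
    (by simp only [map_sub, map_add]; linear_combination 2 * h)
    (by simp only [map_sub, map_add]
        linear_combination (σ y' ^ 2 - σ z' ^ 2) * hbb + (y ^ 2 - z ^ 2) * hσ) with h1 | h1
  · exact Or.inl (sq_eq_sq_iff_eq_or_eq_neg.1 (H.sq_eq_sq_of_norm hκ h1))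
  · exact Or.inr (sq_eq_sq_iff_eq_or_eq_neg.1 (H.sq_eq_sq_of_norm hκ h1))

omit H [Algebra (ZMod 3) F] in
theorem exists_sign_ratio {ε ε' : F} (hε : ε = 1 ∨ ε = -1) (hε' : ε' = 1 ∨ ε' = -1) :
    ∃ κ : F, (κ = 1 ∨ κ = -1) ∧ ε' = κ * ε := by
  rcases hε with rfl | rfl
  · exact ⟨ε', hε', by ring⟩
  · exact ⟨-ε', by rcases hε' with rfl | rfl <;> simp, by ring⟩

theorem eq_of_same_sign {x x' ε ε' y z y' z' : F} (hε : ε = 1 ∨ ε = -1) (hε' : ε' = 1 ∨ ε' = -1)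
    (hy : x + 1 = ε * (y * σ y)) (hz : x = ε * (z * σ z))
    (hy' : x' + 1 = ε' * (y' * σ y')) (hz' : x' = ε' * (z' * σ z'))
    (hb : f (x + 1) - f x ≠ 0) (hbb : f (x' + 1) - f x' = f (x + 1) - f x) : x' = x := by
  have e1 : ε * ε = 1 := by rcases hε with rfl | rfl <;> ring
  have e2 : ε' * ε' = 1 := by rcases hε' with rfl | rfl <;> ring
  have hA : y * σ y - z * σ z = ε := by
    linear_combination ε * hz - ε * hy - (y * σ y - z * σ z) * e1
  have hA' : y' * σ y' - z' * σ z' = ε' := by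
    linear_combination ε' * hz' - ε' * hy' - (y' * σ y' - z' * σ z') * e2
  have fy : f (x + 1) = y ^ 2 := by rw [hy, H.map_sign hε, H.map_norm]
  have fz : f x = z ^ 2 := by rw [hz, H.map_sign hε, H.map_norm]
  have fy' : f (x' + 1) = y' ^ 2 := by rw [hy', H.map_sign hε', H.map_norm]
  have fz' : f x' = z' ^ 2 := by rw [hz', H.map_sign hε', H.map_norm]
  rw [fy, fz] at hb hbb
  rw [fy', fz'] at hbb
  obtain ⟨κ, hκ, hκε⟩ := exists_sign_ratio hε hε'
  obtain ⟨h1, h2⟩ := H.sq_eq_of_norm_sub hκ hb hbb (by rw [hA, hA', hκε])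
  have h1 := norm_eq_norm_of_sq (σ := σ) h1
  have h2 := norm_eq_norm_of_sq (σ := σ) h2
  -- The squares determine the norms, and `N y - N z` is the sign itself.
  have : ε' = ε := by rw [← hA, ← hA', h1, h2]
  rw [hz, hz', h2, this]

theorem eq_of_opposite_sign {x x' ε ε' y z y' z' : F} (hε : ε = 1 ∨ ε = -1)
    (hε' : ε' = 1 ∨ ε' = -1)
    (hy : x + 1 = ε * (y * σ y)) (hz : x = -ε * (z * σ z))
    (hy' : x' + 1 = ε' * (y' * σ y')) (hz' : x' = -ε' * (z' * σ z'))
    (hb : f (x + 1) - f x ≠ 0) (hbb : f (x' + 1) - f x' = f (x + 1) - f x) : x' = x := by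
  have e1 : ε * ε = 1 := by rcases hε with rfl | rfl <;> ring
  have e2 : ε' * ε' = 1 := by rcases hε' with rfl | rfl <;> ring
  have n1 : -ε = 1 ∨ -ε = -1 := by rcases hε with rfl | rfl <;> simp
  have n2 : -ε' = 1 ∨ -ε' = -1 := by rcases hε' with rfl | rfl <;> simp
  have hA : y * σ y + z * σ z = ε := by
    linear_combination ε * hz - ε * hy - (y * σ y + z * σ z) * e1
  have hA' : y' * σ y' + z' * σ z' = ε' := by
    linear_combination ε' * hz' - ε' * hy' - (y' * σ y' + z' * σ z') * e2
  have fy : f (x + 1) = y ^ 2 := by rw [hy, H.map_sign hε, H.map_norm]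
  have fz : f x = z ^ 2 := by rw [hz, H.map_sign n1, H.map_norm]
  have fy' : f (x' + 1) = y' ^ 2 := by rw [hy', H.map_sign hε', H.map_norm]
  have fz' : f x' = z' ^ 2 := by rw [hz', H.map_sign n2, H.map_norm]
  rw [fy, fz] at hb hbb
  rw [fy', fz'] at hbb
  obtain ⟨κ, hκ, hκε⟩ := exists_sign_ratio hε hε'
  obtain ⟨h1, h2⟩ := H.sq_eq_of_norm_add hκ hb hbb (by rw [hA, hA', hκε])
  have h1 := norm_eq_norm_of_sq (σ := σ) h1
  have h2 := norm_eq_norm_of_sq (σ := σ) h2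
  have : ε' = ε := by rw [← hA, ← hA', h1, h2]
  rw [hz, hz', h2, this]

theorem eq_one_of_map_add_one_eq {x : F} (h : f (x + 1) = f x) : x = 1 := by
  obtain ⟨ε, y, hε, hy⟩ := H.exists_sign_mul_norm (x + 1)
  obtain ⟨η, z, hη, hz⟩ := H.exists_sign_mul_norm x
  rw [hy, hz, H.map_sign hε, H.map_sign hη, H.map_norm, H.map_norm] at h
  rw [norm_eq_norm_of_sq h] at hy
  obtain ⟨κ, hκ, hκε⟩ := exists_sign_ratio hη hε
  have hx : x + 1 = κ * x := by rw [hy, hκε, mul_assoc, ← hz]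
  rcases hκ with rfl | rfl
  · exact absurd (by linear_combination hx) (one_ne_zero (α := F))
  · linear_combination x * three_eq_zero (F := F) - hx

variable [Finite F]

theorem differentialCount_one_le (b : F) : differentialCount f 1 b ≤ 2 := by
  by_cases hb : b = 0
  · have : {x : F | f (x + 1) - f x = b} ⊆ {1} := fun x hx =>
      H.eq_one_of_map_add_one_eq (sub_eq_zero.1 (hx.trans hb))
    exact ((Set.ncard_le_ncard this).trans (Set.ncard_singleton _).le).trans (by norm_num)
  -- `A` and `B` separate the solutions by whether `x` and `x + 1` can be given the same or opposite
  -- signs.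
  · let A : Set F := {x | f (x + 1) - f x = b ∧ ∃ ε y z : F, (ε = 1 ∨ ε = -1) ∧
      x + 1 = ε * (y * σ y) ∧ x = ε * (z * σ z)}
    let B : Set F := {x | f (x + 1) - f x = b ∧ ∃ ε y z : F, (ε = 1 ∨ ε = -1) ∧
      x + 1 = ε * (y * σ y) ∧ x = -ε * (z * σ z)}
    have hsub : {x : F | f (x + 1) - f x = b} ⊆ A ∪ B := by
      intro x hx
      obtain ⟨ε, y, hε, hy⟩ := H.exists_sign_mul_norm (x + 1)
      obtain ⟨η, z, hη, hz⟩ := H.exists_sign_mul_norm x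
      obtain ⟨κ, rfl | rfl, hκε⟩ := exists_sign_ratio hε hη
      · exact Or.inl ⟨hx, ε, y, z, hε, hy, by rwa [hκε, one_mul] at hz⟩
      · exact Or.inr ⟨hx, ε, y, z, hε, hy, by rwa [hκε, neg_one_mul] at hz⟩
    have hA : A.ncard ≤ 1 := by
      refine (Set.ncard_le_one_iff (Set.toFinite _)).2 fun {x' x} hx' hx => ?_
      obtain ⟨hx, ε, y, z, hε, hy, hz⟩ := hx
      obtain ⟨hx', ε', y', z', hε', hy', hz'⟩ := hx'
      exact H.eq_of_same_sign hε hε' hy hz hy' hz' (by rwa [hx]) (by rw [hx, hx'])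
    have hB : B.ncard ≤ 1 := by
      refine (Set.ncard_le_one_iff (Set.toFinite _)).2 fun {x' x} hx' hx => ?_
      obtain ⟨hx, ε, y, z, hε, hy, hz⟩ := hx
      obtain ⟨hx', ε', y', z', hε', hy', hz'⟩ := hx'
      exact H.eq_of_opposite_sign hε hε' hy hz hy' hz' (by rwa [hx]) (by rw [hx, hx'])
    calc differentialCount f 1 b ≤ (A ∪ B).ncard := Set.ncard_le_ncard hsub
      _ ≤ A.ncard + B.ncard := Set.ncard_union_le _ _
      _ ≤ 2 := by omega

omit [Finite F] in
theorem differentialCount_eq {a : F} (ha : a ≠ 0) (b : F) :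
    differentialCount f a b = differentialCount f 1 (b / f a) := by
  have hfa : f a ≠ 0 := fun h => by
    have := H.norm_map a
    rw [h, zero_mul] at this
    exact ha (pow_eq_zero_iff two_ne_zero |>.1 this.symm)
  unfold differentialCount
  refine Eq.trans ?_ (Set.ncard_image_of_injective _ (mul_right_injective₀ ha))
  congr 1
  ext x
  constructor
  · intro hx
    refine ⟨x / a, ?_, by field_simp⟩
    change f (x / a + 1) - f (x / a) = b / f a
    rw [eq_div_iff hfa, sub_mul, ← H.map_mul, ← H.map_mul, add_mul, one_mul,
      div_mul_cancel₀ _ ha]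
    exact hx
  · rintro ⟨x, hx, rfl⟩
    change f (a * x + a) - f (a * x) = b
    have hx : f (x + 1) - f x = b / f a := hx
    rw [eq_div_iff hfa] at hx
    rw [show a * x + a = a * (x + 1) by ring, H.map_mul, H.map_mul]
    linear_combination hx

omit [Finite F] in
/-- From a pair `x`, `x + 1` of the same quadratic character one obtains a pair of opposite
quadratic character with the same difference of values of `f`. -/
theorem exists_opposite_sign {ε y z : F} (hε : ε = 1 ∨ ε = -1)
    (h : y * σ y - z * σ z = ε) :
    ∃ ε' z' : F, (ε' = 1 ∨ ε' = -1) ∧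
      f (ε' * (z' * σ z') + 1) - f (ε' * (z' * σ z')) = y ^ 2 - z ^ 2 ∧
      ∃ y', ε' * (z' * σ z') + 1 = -ε' * (y' * σ y') := by
  have h3 := three_eq_zero (F := F)
  have e1 : ε * ε = 1 := by rcases hε with rfl | rfl <;> ring
  have hne : y * σ y - z * σ z ≠ 0 := by
    rw [h]
    rcases hε with rfl | rfl <;> simp
  have hb : y ^ 2 - z ^ 2 ≠ 0 := fun h =>
    hne (sub_eq_zero.2 (norm_eq_norm_of_sq (sub_eq_zero.1 h)))
  have hu : y - z ≠ 0 := fun h => hb (by linear_combination (y + z) * h)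
  have hw : y + z ≠ 0 := fun h => hb (by linear_combination (y - z) * h)
  have hσu : σ (y - z) ≠ 0 := (_root_.map_ne_zero σ).2 hu
  have hσw : σ (y + z) ≠ 0 := (_root_.map_ne_zero σ).2 hw
  -- The new pair is `u + w`, `u - w`, with `u * w = b` and `N u`, `N w` equal to `η` times the two
  -- mixed products of `y - z` and `y + z`. Then `(u + w)² - (u - w)² = 4 * b = b`, and `N (u + w) +
  -- N (u - w) = 4 * η * ε = η * ε`.
  obtain ⟨η, u, hη, hη'⟩ := H.exists_sign_mul_norm (σ (y - z) * (y + z))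
  have e2 : η * η = 1 := by rcases hη with rfl | rfl <;> ring
  have hu0 : u ≠ 0 := by
    rintro rfl
    rw [zero_mul, mul_zero] at hη'
    exact mul_ne_zero hσu hw hη'
  have hσu0 : σ u ≠ 0 := (_root_.map_ne_zero σ).2 hu0
  obtain ⟨w, hwu⟩ : ∃ w, u * w = y ^ 2 - z ^ 2 := ⟨(y ^ 2 - z ^ 2) / u, by field_simp⟩
  have hww : w * σ w = η * ((y - z) * σ (y + z)) := by
    have h1 : (u * w) * σ (u * w) = (y ^ 2 - z ^ 2) * σ (y ^ 2 - z ^ 2) := by rw [hwu]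
    simp only [_root_.map_mul, map_sub, map_add, map_pow] at h1 hη' ⊢
    refine mul_left_cancel₀ (mul_ne_zero hu0 hσu0) ?_
    linear_combination h1 + (y - z) * (σ y + σ z) * hη'
  have huu : u * σ u = η * (σ (y - z) * (y + z)) := by
    linear_combination -(u * σ u) * e2 - η * hη'
  have hsum : (u + w) * σ (u + w) + (u - w) * σ (u - w) = η * ε := by
    simp only [map_sub, map_add] at huu hww ⊢
    linear_combination 2 * huu + 2 * hww + 4 * η * h + η * ε * h3
  have hs : -(η * ε) = 1 ∨ -(η * ε) = -1 := by
    rcases hε with rfl | rfl <;> rcases hη with rfl | rfl <;> simp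
  have hs' : η * ε = 1 ∨ η * ε = -1 := by
    rcases hε with rfl | rfl <;> rcases hη with rfl | rfl <;> simp
  have hx : -(η * ε) * ((u - w) * σ (u - w)) + 1 = - -(η * ε) * ((u + w) * σ (u + w)) := by
    linear_combination -η * ε * hsum - e2 - η ^ 2 * e1
  refine ⟨-(η * ε), u - w, hs, ?_, u + w, hx⟩
  rw [hx, neg_neg, H.map_sign hs, H.map_sign hs', H.map_norm, H.map_norm]
  linear_combination 4 * hwu + (y ^ 2 - z ^ 2) * h3

theorem exists_differentialCount_eq_two {r : F} (h0 : r ≠ 0) (h1 : r ≠ 1) (h2 : r ≠ -1) :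
    ∃ b, differentialCount f 1 b = 2 := by
  have hr : 1 - r ^ 2 ≠ 0 := fun h => by
    rcases mul_eq_zero.1 (show (r - 1) * (r + 1) = 0 by linear_combination -h) with h | h
    · exact h1 (sub_eq_zero.1 h)
    · exact h2 (eq_neg_of_add_eq_zero_left h)
  -- The starting point has `x + 1 = 1 / (1 - r²)` and `x = r² / (1 - r²)`: their ratio is a nonzero
  -- square, so the signs agree.
  obtain ⟨ε, y, hε, hy⟩ := H.exists_sign_mul_norm (1 / (1 - r ^ 2))
  have e1 : ε * ε = 1 := by rcases hε with rfl | rfl <;> ring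
  have hy1 : ε * (y * σ y) * (1 - r ^ 2) = 1 := by rw [← hy]; field_simp
  set z := y * f r with hz
  have hzz : z * σ z = y * σ y * r ^ 2 := by
    rw [hz, _root_.map_mul, ← H.norm_map r]; ring
  have h : y * σ y - z * σ z = ε := by
    rw [hzz]; linear_combination ε * hy1 - y * σ y * (1 - r ^ 2) * e1
  have hx : ε * (z * σ z) + 1 = ε * (y * σ y) := by linear_combination -e1 - ε * h
  obtain ⟨ε', z', hε', hb, y', hy'⟩ := H.exists_opposite_sign hε h
  have n' : -ε' = 1 ∨ -ε' = -1 := by rcases hε' with rfl | rfl <;> simp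
  have hne : ε * (z * σ z) ≠ ε' * (z' * σ z') := by
    intro hxx
    have hyy : ε * (y * σ y) = -ε' * (y' * σ y') := by rw [← hx, ← hy', hxx]
    have hfz := congrArg f hxx
    have hfy := congrArg f hyy
    rw [H.map_sign hε, H.map_sign hε', H.map_norm, H.map_norm] at hfz
    rw [H.map_sign hε, H.map_sign n', H.map_norm, H.map_norm] at hfy
    rw [norm_eq_norm_of_sq hfz] at hxx
    rw [norm_eq_norm_of_sq hfy] at hyy
    have hy0 : y * σ y ≠ 0 := fun h => by simp [h] at hy1
    have hz0 : z * σ z ≠ 0 := by rw [hzz]; exact mul_ne_zero hy0 (pow_ne_zero 2 h0)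
    rw [norm_eq_norm_of_sq hfz] at hz0
    rw [norm_eq_norm_of_sq hfy] at hy0
    have a1 := mul_right_cancel₀ hz0 hxx
    have a2 := mul_right_cancel₀ hy0 hyy
    have : ε = 0 := by linear_combination ε * three_eq_zero (F := F) - a1 - a2
    rw [this, zero_mul] at e1
    exact zero_ne_one e1
  refine ⟨y ^ 2 - z ^ 2, le_antisymm (H.differentialCount_one_le _) ?_⟩
  refine (Set.ncard_pair hne).symm.le.trans (Set.ncard_le_ncard ?_)
  rintro x (rfl | rfl)
  · change f (_ + 1) - f _ = _
    rw [hx, H.map_sign hε, H.map_sign hε, H.map_norm, H.map_norm]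
  · exact hb

theorem isAPN {r : F} (h0 : r ≠ 0) (h1 : r ≠ 1) (h2 : r ≠ -1) : IsAPN f := by
  refine ⟨fun a b ha => ?_, ?_⟩
  · rw [H.differentialCount_eq ha]
    exact H.differentialCount_one_le _
  · obtain ⟨b, hb⟩ := H.exists_differentialCount_eq_two h0 h1 h2
    exact ⟨1, b, one_ne_zero, hb⟩

end Basic

end IsSquaringPair

/-! ### Trace quadratic forms and their radicals. -/

section Trace

variable {F : Type*} [Field F] [Algebra (ZMod 3) F]

/-- The quadratic form `y ↦ Tr (y ^ 2 + v * y * σ y)`. -/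
noncomputable def traceQuadraticForm (σ : F ≃ₐ[ZMod 3] F) (v : F) : QuadraticForm (ZMod 3) F :=
  LinearMap.BilinMap.toQuadraticMap <| LinearMap.mk₂ (ZMod 3)
    (fun y z => Algebra.trace (ZMod 3) F (y * z + v * (y * σ z)))
    (fun y y' z => by rw [← map_add]; congr 1; ring)
    (fun c y z => by rw [← map_smul]; congr 1; simp [smul_add])
    (fun y z z' => by rw [← map_add]; congr 1; rw [map_add]; ring)
    (fun c y z => by rw [← map_smul]; congr 1; simp [smul_add])

theorem traceQuadraticForm_apply (σ : F ≃ₐ[ZMod 3] F) (v y : F) :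
    traceQuadraticForm σ v y = Algebra.trace (ZMod 3) F (y * y + v * (y * σ y)) := rfl

variable [Fintype F]

theorem exists_trace_mul_eq_one {a : F} (ha : a ≠ 0) :
    ∃ b, Algebra.trace (ZMod 3) F (a * b) = 1 := by
  by_contra! hne
  refine ha ((traceForm_nondegenerate (ZMod 3) F).1 a fun b => ?_)
  rw [Algebra.traceForm_apply]
  have h1 := hne b
  have h2 := hne (-b)
  rw [mul_neg, map_neg] at h2
  generalize Algebra.trace (ZMod 3) F (a * b) = t at h1 h2 ⊢
  revert t; decide

omit [Fintype F] in
theorem polar_traceQuadraticForm (σ : F ≃ₐ[ZMod 3] F) (v y z : F) :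
    QuadraticMap.polar (traceQuadraticForm σ v) y z =
      Algebra.trace (ZMod 3) F ((σ v * σ (σ y) - σ y + v * y) * σ z) := by
  have h : QuadraticMap.polar (traceQuadraticForm σ v) y z =
      Algebra.trace (ZMod 3) F (y * z + v * (y * σ z)) +
        Algebra.trace (ZMod 3) F (z * y + v * (z * σ y)) :=
    LinearMap.BilinMap.polar_toQuadraticMap _ _
  -- Applying `σ` under the trace to the terms containing `z` makes the whole expression linear in
  -- `σ z`.
  have h1 : Algebra.trace (ZMod 3) F (2 * y * z + v * z * σ y) =
      Algebra.trace (ZMod 3) F (σ (2 * y * z + v * z * σ y)) :=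
    (Algebra.trace_eq_of_algEquiv σ _).symm
  have h2 : y * z + v * (y * σ z) + (z * y + v * (z * σ y)) =
      (2 * y * z + v * z * σ y) + v * y * σ z := by ring
  rw [h, ← map_add, h2, map_add, h1, ← map_add]
  congr 1
  simp only [map_add, map_mul, map_ofNat]
  linear_combination σ y * σ z * IsSquaringPair.three_eq_zero (F := F)

theorem polar_traceQuadraticForm_eq_zero_iff (σ : F ≃ₐ[ZMod 3] F) (v y : F) :
    (∀ z, QuadraticMap.polar (traceQuadraticForm σ v) y z = 0) ↔
      σ v * σ (σ y) - σ y + v * y = 0 := by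
  simp_rw [polar_traceQuadraticForm]
  constructor
  · intro h
    by_contra hne
    obtain ⟨b, hb⟩ := exists_trace_mul_eq_one hne
    have := h (σ.symm b)
    rw [AlgEquiv.apply_symm_apply, hb] at this
    exact absurd this (by decide)
  · intro h z
    rw [h, zero_mul, map_zero]

theorem sum_charTrace_trace_mul [DecidableEq F] (a : F) :
    ∑ x : F, charTrace (Algebra.trace (ZMod 3) F (a * x)) =
      if a = 0 then 2 * (Fintype.card F : ℤ) else 0 := by
  split_ifs with ha
  · subst ha
    simp [charTrace, mul_comm]
  · obtain ⟨b, hb⟩ := exists_trace_mul_eq_one ha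
    have h1 := Equiv.sum_comp (Equiv.addRight b)
      fun x => charTrace (Algebra.trace (ZMod 3) F (a * x))
    have h2 := Equiv.sum_comp (Equiv.addRight (-b))
      fun x => charTrace (Algebra.trace (ZMod 3) F (a * x))
    simp only [Equiv.coe_addRight, mul_add, map_add, mul_neg, map_neg, hb] at h1 h2
    have h3 : ∀ t : ZMod 3, charTrace t + charTrace (t + 1) + charTrace (t + -1) = 0 := by decide
    have h4 := Finset.sum_eq_zero fun (x : F) (_ : x ∈ Finset.univ) =>
      h3 (Algebra.trace (ZMod 3) F (a * x))
    rw [Finset.sum_add_distrib, Finset.sum_add_distrib, h1, h2] at h4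
    linarith

namespace IsSquaringPair

variable {σ : F ≃ₐ[ZMod 3] F} {f : F → F} (H : IsSquaringPair σ f)
include H

/-- `N` is two-to-one away from 0. Giving it the sign of the quadratic character of `y` makes it
odd, hence a bijection, and an even `g` does not see the sign. -/
theorem sum_even_eq_sum_norm {g : F → ℤ} (hg : ∀ x, g (-x) = g x) :
    ∑ x, g x = ∑ y, g (y * σ y) := by
  classical
  let Φ : F → F := fun y => if IsSquare y then y * σ y else -(y * σ y)
  have hΦ : ∀ y, ∃ ε : F, (ε = 1 ∨ ε = -1) ∧ Φ y = ε * (y * σ y) := by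
    intro y
    by_cases hy : IsSquare y
    · exact ⟨1, Or.inl rfl, by simp [Φ, hy]⟩
    · exact ⟨-1, Or.inr rfl, by simp [Φ, hy]⟩
  have hfΦ : ∀ y, f (Φ y) = y ^ 2 := by
    intro y
    obtain ⟨ε, hε, h⟩ := hΦ y
    rw [h, H.map_sign hε, H.map_norm]
  have hinj : Function.Injective Φ := by
    intro y z hyz
    have h : y ^ 2 = z ^ 2 := by rw [← hfΦ y, ← hfΦ z, hyz]
    rcases sq_eq_sq_iff_eq_or_eq_neg.1 h with h | rfl
    · exact h
    · by_cases hz : z = 0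
      · rw [hz, neg_zero]
      · exfalso
        have hneg : Φ (-z) = -Φ z := by
          have hsq : IsSquare (-z) ↔ ¬ IsSquare z := by
            constructor
            · intro h1 h2
              apply H.not_isSquare
              have := h1.div h2
              rwa [neg_div, div_self hz] at this
            · exact fun h => (H.isSquare_or z).resolve_left h
          by_cases h : IsSquare z <;> simp [Φ, hsq, h]
        rw [hneg] at hyz
        have h0 : Φ z = 0 := by
          linear_combination Φ z * three_eq_zero (F := F) + hyz
        have := hfΦ z
        rw [h0] at this
        have hf0 := H.map_norm 0
        rw [zero_mul] at hf0
        rw [hf0] at this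
        exact hz (pow_eq_zero_iff two_ne_zero |>.1 (by rw [← this]; ring))
  have hbij := Finite.injective_iff_bijective.1 hinj
  rw [← Function.Bijective.sum_comp hbij]
  refine Finset.sum_congr rfl fun y _ => ?_
  obtain ⟨ε, rfl | rfl, h⟩ := hΦ y
  · rw [h, one_mul]
  · rw [h, neg_one_mul, hg]

omit [Fintype F] in
/-- The radicals attached to `v` and `-v` cannot both be nontrivial. -/
theorem radical_trivial_or {v y z : F} (hv : v ≠ 0)
    (hy : σ v * σ (σ y) - σ y + v * y = 0) (hz : σ (-v) * σ (σ z) - σ z + (-v) * z = 0) :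
    y = 0 ∨ z = 0 := by
  by_contra! hne
  obtain ⟨hy0, hz0⟩ := hne
  rw [_root_.map_neg] at hz
  have hσy : σ y ≠ 0 := (_root_.map_ne_zero σ).2 hy0
  -- Eliminating the `σ²` terms between the two radical equations shows that `σ` negates this
  -- element.
  have hW : v * (y * σ z + z * σ y) = 0 := by
    refine H.eq_zero_of_map_eq_neg ?_
    simp only [_root_.map_mul, _root_.map_add]
    linear_combination σ z * hy - σ y * hz
  have hW' := (mul_eq_zero.1 hW).resolve_left hv
  have hr : σ (z / y) = -(z / y) := by
    rw [map_div₀]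
    field_simp
    linear_combination hW'
  exact div_ne_zero hz0 hy0 (H.eq_zero_of_map_eq_neg hr)

/-- For a fixed nonzero `y` in the radical, `z ↦ v * (y * σ z - z * σ y)` takes `σ`-fixed values on
it, so at most three. Two points of a fibre differ by a `σ`-fixed multiple of `y`, so fibres have at
most three elements. -/
theorem ncard_radical_le {v : F} (hv : v ≠ 0) :
    Set.ncard {y : F | σ v * σ (σ y) - σ y + v * y = 0} ≤ 9 := by
  classical
  rw [Set.ncard_eq_toFinset_card']
  set s := {y : F | σ v * σ (σ y) - σ y + v * y = 0}.toFinset with hs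
  have hmem : ∀ y, y ∈ s ↔ σ v * σ (σ y) - σ y + v * y = 0 := by simp [hs]
  by_cases h : ∃ y ∈ s, y ≠ 0
  · obtain ⟨y, hy, hy0⟩ := h
    rw [hmem] at hy
    have hcard : ({0, 1, -1} : Finset F).card ≤ 3 := Finset.card_le_three
    refine (Finset.card_le_mul_card_image_of_maps_to (f := fun z => v * (y * σ z - z * σ y))
      (t := {0, 1, -1}) ?_ 3 ?_).trans (by omega)
    · intro z hz
      rw [hmem] at hz
      have := H.fixed (v * (y * σ z - z * σ y)) (by
        simp only [_root_.map_mul, map_sub]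
        linear_combination σ y * hz - σ z * hy)
      simpa using this
    · intro b _
      by_cases hb : ∃ z ∈ s, v * (y * σ z - z * σ y) = b
      · obtain ⟨z, hz, hzb⟩ := hb
        refine (Finset.card_le_card (t := ({0, 1, -1} : Finset F).image fun t => z + t * y)
          ?_).trans (Finset.card_image_le.trans hcard)
        intro w hw
        rw [Finset.mem_filter] at hw
        have h1 : y * σ (w - z) = (w - z) * σ y := by
          refine mul_left_cancel₀ hv ?_
          rw [map_sub]
          linear_combination hw.2 - hzb
        have hσy : σ y ≠ 0 := (_root_.map_ne_zero σ).2 hy0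
        have h2 := H.fixed ((w - z) / y) (by
          rw [map_div₀]
          field_simp
          linear_combination h1)
        rw [Finset.mem_image]
        exact ⟨(w - z) / y, by simpa using h2, by field_simp; ring⟩
      · rw [Finset.filter_eq_empty_iff.2 fun z hz hzb => hb ⟨z, hz, hzb⟩]
        simp
  · push Not at h
    have : s ⊆ {0} := fun y hy => by simpa using h y hy
    exact (Finset.card_le_card this).trans (by simp)

omit H in
theorem sum_charTrace_eq_zero (hodd : Odd (Module.finrank (ZMod 3) F)) {v : F}
    (hv : ∀ y, σ v * σ (σ y) - σ y + v * y = 0 → y = 0) :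
    ∑ y, charTrace (traceQuadraticForm σ v y) = 0 := by
  obtain ⟨r, c, hrc, hcard, h1, -⟩ := exists_card_radical_and_sum_charTrace (traceQuadraticForm σ v)
  simp_rw [polar_traceQuadraticForm_eq_zero_iff] at hcard
  have h0 : {y : F | σ v * σ (σ y) - σ y + v * y = 0} = {0} := by
    ext y
    exact ⟨hv y, fun h => by rw [Set.mem_singleton_iff.1 h]; simp⟩
  rw [h0, Set.ncard_singleton] at hcard
  have hc : c = 0 := by
    rcases Nat.eq_zero_or_pos c with h | h
    · exact h
    · exact absurd hcard (Nat.one_lt_pow h.ne' (by norm_num)).ne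
  rw [hc, add_zero] at hrc
  exact h1 (hrc ▸ hodd)

theorem sum_charTrace_cases {j : ℕ} (hj : Module.finrank (ZMod 3) F = 2 * j + 3) {v : F}
    (hv : v ≠ 0) :
    ∃ τ : ℤ, (τ = 0 ∨ τ = 1 ∨ τ = -1) ∧
      ∑ y, charTrace (traceQuadraticForm σ v y) = 18 * τ * 3 ^ j := by
  obtain ⟨r, c, hrc, hcard, h1, h2⟩ := exists_card_radical_and_sum_charTrace (traceQuadraticForm σ v)
  simp_rw [polar_traceQuadraticForm_eq_zero_iff] at hcard
  have h9 := H.ncard_radical_le hv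
  rw [hcard] at h9
  have hc : c ≤ 2 := (Nat.pow_le_pow_iff_right (by norm_num : 1 < 3)).1 h9
  rw [hj] at hrc
  -- The dimension is odd, so among `c ≤ 2` only `c = 1` gives even rank, namely `2 * (j + 1)`.
  by_cases hc1 : c = 1
  · have h3 := h2 (j + 1) (by omega)
    rw [hc1, show 1 + (j + 1) = j + 2 by ring, pow_add] at h3
    rcases h3 with h3 | h3
    · exact ⟨1, by simp, by rw [h3]; ring⟩
    · exact ⟨-1, by simp, by rw [h3]; ring⟩
  · refine ⟨0, by simp, ?_⟩
    rw [h1 (by rw [Nat.odd_iff]; omega)]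
    ring

theorem sum_charTrace_add_cases {j : ℕ} (hj : Module.finrank (ZMod 3) F = 2 * j + 3) {v : F}
    (hv : v ≠ 0) :
    ∃ τ : ℤ, (τ = 0 ∨ τ = 1 ∨ τ = -1) ∧
      ∑ y, charTrace (traceQuadraticForm σ v y) + ∑ y, charTrace (traceQuadraticForm σ (-v) y) =
        18 * τ * 3 ^ j := by
  have hodd : Odd (Module.finrank (ZMod 3) F) := by rw [hj, Nat.odd_iff]; omega
  by_cases h : ∃ z, σ (-v) * σ (σ z) - σ z + (-v) * z = 0 ∧ z ≠ 0
  · obtain ⟨z, hz, hz0⟩ := h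
    obtain ⟨τ, hτ, h⟩ := H.sum_charTrace_cases hj (neg_ne_zero.2 hv)
    refine ⟨τ, hτ, ?_⟩
    rw [h, sum_charTrace_eq_zero hodd, zero_add]
    exact fun y hy => (H.radical_trivial_or hv hy hz).resolve_right hz0
  · push Not at h
    obtain ⟨τ, hτ, h'⟩ := H.sum_charTrace_cases hj hv
    refine ⟨τ, hτ, ?_⟩
    rw [h', sum_charTrace_eq_zero hodd h, add_zero]

end IsSquaringPair

end Trace

/-! ### Moments and the weight distribution. -/

namespace IsSquaringPair

section Count

variable {F : Type*} [Field F] [Algebra (ZMod 3) F] [Fintype F]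

/-- The set of `b` with `Tr (f b) = 0`. -/
noncomputable def traceKernel (f : F → F) : Finset F :=
  Finset.univ.filter fun b => Algebra.trace (ZMod 3) F (f b) = 0

/-- The number of `b` with `Tr (f b) = 0` and `Tr (b * x) = 0`. -/
noncomputable def zeroCount (f : F → F) (x : F) : ℕ :=
  ((traceKernel f).filter fun b => Algebra.trace (ZMod 3) F (b * x) = 0).card

theorem three_mul_zeroCount (f : F → F) (x : F) :
    (3 : ℤ) * zeroCount f x =
      ∑ b ∈ traceKernel f, (1 + charTrace (Algebra.trace (ZMod 3) F (b * x))) := by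
  rw [zeroCount, Finset.card_filter]
  push_cast
  rw [Finset.mul_sum]
  exact Finset.sum_congr rfl fun b _ => three_mul_indicator_eq _

variable {σ : F ≃ₐ[ZMod 3] F} {f : F → F} (H : IsSquaringPair σ f)

omit [Fintype F] in
include H in
theorem map_zero : f 0 = 0 := by
  simpa using H.map_norm 0

include H in
theorem zero_mem_traceKernel : (0 : F) ∈ traceKernel f := by
  simp [traceKernel, H.map_zero]

include H in
theorem sum_charTrace_map (hodd : Odd (Module.finrank (ZMod 3) F)) :
    ∑ b, charTrace (Algebra.trace (ZMod 3) F (f b)) = 0 := by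
  rw [H.sum_even_eq_sum_norm (g := fun b => charTrace (Algebra.trace (ZMod 3) F (f b)))
    (fun x => by rw [H.map_neg])]
  rw [← sum_charTrace_eq_zero (σ := σ) hodd (v := 0) fun y hy => by simpa using hy]
  refine Finset.sum_congr rfl fun y _ => ?_
  rw [H.map_norm, traceQuadraticForm_apply, zero_mul, add_zero, sq]

include H in
theorem three_mul_card_traceKernel (hodd : Odd (Module.finrank (ZMod 3) F)) :
    3 * (traceKernel f).card = Fintype.card F := by
  have h : (3 : ℤ) * (traceKernel f).card = Fintype.card F := by
    rw [traceKernel, Finset.card_filter]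
    push_cast
    rw [Finset.mul_sum]
    simp_rw [three_mul_indicator_eq]
    rw [Finset.sum_add_distrib, H.sum_charTrace_map hodd]
    simp
  exact_mod_cast h

include H in
-- Of the five terms of the joint indicator, those in `Tr (f b)` and `Tr (b * x)` alone sum to zero.
-- The last two are exchanged by `b ↦ -b`, so only their sum is even and admits the norm
-- substitution, giving the forms for `x` and `-x`.
theorem nine_mul_zeroCount (hodd : Odd (Module.finrank (ZMod 3) F)) {x : F} (hx : x ≠ 0) :
    (9 : ℤ) * zeroCount f x = Fintype.card F + (∑ y, charTrace (traceQuadraticForm σ x y) +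
      ∑ y, charTrace (traceQuadraticForm σ (-x) y)) := by
  classical
  rw [zeroCount, traceKernel, Finset.filter_filter, Finset.card_filter]
  push_cast
  rw [Finset.mul_sum]
  simp_rw [nine_mul_indicator_eq, add_assoc]
  rw [Finset.sum_add_distrib, Finset.sum_add_distrib, Finset.sum_add_distrib,
    H.sum_charTrace_map hodd,
    H.sum_even_eq_sum_norm (g := fun b =>
      charTrace (Algebra.trace (ZMod 3) F (f b) + Algebra.trace (ZMod 3) F (b * x)) +
      charTrace (Algebra.trace (ZMod 3) F (f b) - Algebra.trace (ZMod 3) F (b * x)))]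
  · have h := sum_charTrace_trace_mul x
    rw [if_neg hx] at h
    simp_rw [mul_comm x] at h
    rw [h, ← Finset.sum_add_distrib]
    simp only [Finset.sum_const, Finset.card_univ, nsmul_eq_mul, mul_one, zero_add]
    congr 1
    refine Finset.sum_congr rfl fun y _ => ?_
    rw [H.map_norm, traceQuadraticForm_apply, traceQuadraticForm_apply, ← map_add, ← map_sub]
    congr 3 <;> ring
  · intro b
    rw [H.map_neg, neg_mul, _root_.map_neg, sub_neg_eq_add, ← sub_eq_add_neg, add_comm]

variable {j : ℕ} (hj : Module.finrank (ZMod 3) F = 2 * j + 3)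

include hj in
theorem card_eq_of_finrank : Fintype.card F = 27 * (3 ^ j) ^ 2 := by
  rw [Module.card_eq_pow_finrank (K := ZMod 3) (V := F), hj, ZMod.card]
  ring

include hj in
omit [Fintype F] in
theorem odd_finrank : Odd (Module.finrank (ZMod 3) F) := by
  rw [hj, Nat.odd_iff]; omega

include H hj in
theorem card_traceKernel : (traceKernel f).card = 9 * (3 ^ j) ^ 2 := by
  have h := H.three_mul_card_traceKernel (odd_finrank hj)
  rw [card_eq_of_finrank hj] at h
  omega

include H hj in
theorem zeroCount_cases {x : F} (hx : x ≠ 0) :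
    ∃ τ : ℤ, (τ = 0 ∨ τ = 1 ∨ τ = -1) ∧ (zeroCount f x : ℤ) = 3 * (3 ^ j) ^ 2 + 2 * τ * 3 ^ j := by
  obtain ⟨τ, hτ, h⟩ := H.sum_charTrace_add_cases hj hx
  refine ⟨τ, hτ, ?_⟩
  have h' := H.nine_mul_zeroCount (odd_finrank hj) hx
  rw [h, card_eq_of_finrank hj] at h'
  push_cast at h'
  linarith

include H hj in
theorem sum_zeroCount :
    ∑ x, (zeroCount f x : ℤ) = 9 * (3 ^ j) ^ 2 * (9 * (3 ^ j) ^ 2 + 2) := by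
  classical
  have h : (3 : ℤ) * ∑ x, (zeroCount f x : ℤ) =
      Fintype.card F * (traceKernel f).card + 2 * Fintype.card F := by
    rw [Finset.mul_sum]
    simp_rw [three_mul_zeroCount]
    rw [Finset.sum_comm]
    simp_rw [Finset.sum_add_distrib, sum_charTrace_trace_mul]
    rw [Finset.sum_ite_eq', if_pos H.zero_mem_traceKernel]
    simp [mul_comm]
  rw [H.card_traceKernel hj, card_eq_of_finrank hj] at h
  push_cast at h
  linarith

include H in
theorem neg_mem_traceKernel_iff (b : F) :
    -b ∈ traceKernel f ↔ b ∈ traceKernel f := by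
  simp [traceKernel, H.map_neg]

include H hj in
theorem sum_sq_zeroCount :
    ∑ x, (zeroCount f x : ℤ) ^ 2 = 27 * (3 ^ j) ^ 4 * (9 * (3 ^ j) ^ 2 + 8) := by
  classical
  have h : (9 : ℤ) * ∑ x, (zeroCount f x : ℤ) ^ 2 =
      Fintype.card F * ((traceKernel f).card ^ 2 + 8 * (traceKernel f).card) := by
    have h1 : ∀ x : F, (9 : ℤ) * (zeroCount f x : ℤ) ^ 2 =
        ∑ b ∈ traceKernel f, ∑ c ∈ traceKernel f,
          (1 + charTrace (Algebra.trace (ZMod 3) F (b * x)) +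
            charTrace (Algebra.trace (ZMod 3) F (c * x)) +
            charTrace (Algebra.trace (ZMod 3) F ((b + c) * x)) +
            charTrace (Algebra.trace (ZMod 3) F ((b - c) * x))) := by
      intro x
      rw [show (9 : ℤ) * (zeroCount f x : ℤ) ^ 2 =
        (3 * (zeroCount f x : ℤ)) * (3 * (zeroCount f x : ℤ)) by ring, three_mul_zeroCount,
        Finset.sum_mul_sum]
      refine Finset.sum_congr rfl fun b _ => Finset.sum_congr rfl fun c _ => ?_
      rw [add_mul b c x, sub_mul b c x, map_add, map_sub]
      linear_combination charTrace_mul (Algebra.trace (ZMod 3) F (b * x))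
        (Algebra.trace (ZMod 3) F (c * x))
    rw [Finset.mul_sum]
    simp_rw [h1]
    rw [Finset.sum_comm]
    -- Orthogonality leaves `c = 0`, `c = -b` and `c = b`, each contributing twice the field size;
    -- the kernel contains `-b` because `f` is even.
    have h2 : ∀ b ∈ traceKernel f, ∑ x : F, ∑ c ∈ traceKernel f,
          (1 + charTrace (Algebra.trace (ZMod 3) F (b * x)) +
            charTrace (Algebra.trace (ZMod 3) F (c * x)) +
            charTrace (Algebra.trace (ZMod 3) F ((b + c) * x)) +
            charTrace (Algebra.trace (ZMod 3) F ((b - c) * x))) =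
        Fintype.card F * (traceKernel f).card +
          (traceKernel f).card * (if b = 0 then 2 * (Fintype.card F : ℤ) else 0) +
          6 * Fintype.card F := by
      intro b hb
      rw [Finset.sum_comm]
      simp_rw [Finset.sum_add_distrib, sum_charTrace_trace_mul, add_eq_zero_iff_eq_neg',
        sub_eq_zero]
      rw [Finset.sum_ite_eq', if_pos H.zero_mem_traceKernel, Finset.sum_ite_eq', Finset.sum_ite_eq,
        if_pos ((H.neg_mem_traceKernel_iff b).2 hb), if_pos hb]
      simp only [Finset.sum_const, Finset.card_univ, nsmul_eq_mul]
      ring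
    rw [Finset.sum_congr rfl h2, Finset.sum_add_distrib, Finset.sum_add_distrib,
      ← Finset.mul_sum (traceKernel f) _ ((traceKernel f).card : ℤ), Finset.sum_ite_eq',
      if_pos H.zero_mem_traceKernel]
    simp only [Finset.sum_const, nsmul_eq_mul]
    ring
  rw [H.card_traceKernel hj, card_eq_of_finrank hj] at h
  push_cast at h
  linarith

/-- The number of `b` with `Tr (f b) = 0` and `Tr (b * x) ≠ 0`. -/
noncomputable def traceWeight (f : F → F) (x : F) : ℕ :=
  ((traceKernel f).filter fun b => ¬ Algebra.trace (ZMod 3) F (b * x) = 0).card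

theorem zeroCount_add_traceWeight (f : F → F) (x : F) :
    zeroCount f x + traceWeight f x = (traceKernel f).card :=
  Finset.card_filter_add_card_filter_not _

include H hj in
/-- The weight distribution, encoded by a sign function `τ` on the nonzero elements. -/
theorem exists_sign_traceWeight :
    ∃ τ : F → ℤ, τ 0 = 0 ∧ (∀ x, τ x = 0 ∨ τ x = 1 ∨ τ x = -1) ∧
      (∀ x, x ≠ 0 → (traceWeight f x : ℤ) = 6 * (3 ^ j) ^ 2 - 2 * τ x * 3 ^ j) ∧
      ∑ x, τ x = 6 * 3 ^ j ∧ ∑ x, τ x ^ 2 = 18 * (3 ^ j) ^ 2 := by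
  classical
  have hex : ∀ x : F, ∃ τ : ℤ, (x = 0 → τ = 0) ∧ (τ = 0 ∨ τ = 1 ∨ τ = -1) ∧
      -- At `x = 0` the count is the whole kernel, `9 * (3 ^ j) ^ 2`; the correction term permits
      -- the default `τ = 0` there.
      (zeroCount f x : ℤ) = (if x = 0 then 6 * (3 ^ j) ^ 2 else 0) + 3 * (3 ^ j) ^ 2 +
        2 * τ * 3 ^ j := by
    intro x
    by_cases hx : x = 0
    · refine ⟨0, fun _ => rfl, Or.inl rfl, ?_⟩
      have : zeroCount f x = (traceKernel f).card := by simp [zeroCount, hx]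
      rw [this, H.card_traceKernel hj, if_pos hx]
      push_cast
      ring
    · obtain ⟨τ, hτ, h⟩ := H.zeroCount_cases hj hx
      exact ⟨τ, fun h => absurd h hx, hτ, by rw [h, if_neg hx, zero_add]⟩
  choose τ h0 hτ h using hex
  have hP : (3 : ℤ) ^ j ≠ 0 := by positivity
  have hq : (Fintype.card F : ℤ) = 27 * (3 ^ j) ^ 2 := by exact_mod_cast card_eq_of_finrank hj
  have h1 : ∑ x, τ x = 6 * 3 ^ j := by
    have hs := H.sum_zeroCount hj
    simp_rw [h] at hs
    rw [Finset.sum_add_distrib, Finset.sum_add_distrib, ← Finset.sum_mul _ _ ((3 : ℤ) ^ j),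
      ← Finset.mul_sum _ _ (2 : ℤ), Finset.sum_ite_eq', if_pos (Finset.mem_univ _)] at hs
    simp only [Finset.sum_const, Finset.card_univ, nsmul_eq_mul, hq] at hs
    refine mul_left_cancel₀ (mul_ne_zero two_ne_zero hP) ?_
    linear_combination hs
  refine ⟨τ, h0 0 rfl, hτ, fun x hx => ?_, h1, ?_⟩
  · have h2 : (zeroCount f x : ℤ) + traceWeight f x = 9 * (3 ^ j) ^ 2 := by
      exact_mod_cast (zeroCount_add_traceWeight f x).trans (H.card_traceKernel hj)
    rw [h, if_neg hx] at h2
    linear_combination h2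
  · have hs := H.sum_sq_zeroCount hj
    have h2 : ∀ x : F, (zeroCount f x : ℤ) ^ 2 = (if x = 0 then 72 * (3 ^ j) ^ 4 else 0) +
        9 * (3 ^ j) ^ 4 + 12 * (3 ^ j) ^ 3 * τ x + 4 * (3 ^ j) ^ 2 * τ x ^ 2 := by
      intro x
      rw [h]
      by_cases hx : x = 0
      · rw [if_pos hx, if_pos hx, h0 x hx]; ring
      · rw [if_neg hx, if_neg hx]; ring
    simp_rw [h2] at hs
    rw [Finset.sum_add_distrib, Finset.sum_add_distrib, Finset.sum_add_distrib,
      ← Finset.mul_sum _ _ (12 * ((3 : ℤ) ^ j) ^ 3), ← Finset.mul_sum _ _ (4 * ((3 : ℤ) ^ j) ^ 2),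
      Finset.sum_ite_eq', if_pos (Finset.mem_univ _), h1] at hs
    simp only [Finset.sum_const, Finset.card_univ, nsmul_eq_mul, hq] at hs
    refine mul_left_cancel₀ (mul_ne_zero (four_ne_zero (α := ℤ)) (pow_ne_zero 2 hP)) ?_
    linear_combination hs

include H hj in
theorem traceWeight_pos {x : F} (hx : x ≠ 0) : 0 < traceWeight f x := by
  obtain ⟨τ, -, hτ, hw, -⟩ := H.exists_sign_traceWeight hj
  have h := hw x hx
  have hP : (1 : ℤ) ≤ 3 ^ j := one_le_pow₀ (by norm_num)
  have : (0 : ℤ) < traceWeight f x := by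
    rw [h]
    rcases hτ x with h | h | h <;> rw [h] <;> nlinarith
  exact_mod_cast this

include H hj in
theorem card_traceWeight_eq (w : ℕ) :
    (Finset.univ.filter fun x : F => traceWeight f x = w).card =
      threeWeightFrequency (2 * j + 3) 1 w := by
  classical
  obtain ⟨τ, h0, hτ, hw, h1, h2⟩ := H.exists_sign_traceWeight hj
  have hw0 : traceWeight f 0 = 0 := by simp [traceWeight]
  have hpos := fun x => H.traceWeight_pos hj (x := x)
  have hq : (Fintype.card F : ℤ) = 27 * (3 ^ j) ^ 2 := by exact_mod_cast card_eq_of_finrank hj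
  have e1 : 2 * j + 3 - 2 = 2 * j + 1 := by omega
  have e2 : (2 * j + 3 + 1) / 2 - 2 = j := by omega
  have e3 : 2 * j + 3 - 1 = 2 * j + 2 := by omega
  have e4 : (2 * j + 2) / 2 = j + 1 := by omega
  have p1 : 3 ^ (2 * j + 1) = 3 * (3 ^ j) ^ 2 := by ring
  have p2 : 3 ^ (2 * j + 2) = 9 * (3 ^ j) ^ 2 := by ring
  have p3 : 3 ^ (2 * j + 3) = 27 * (3 ^ j) ^ 2 := by ring
  have p4 : 3 ^ (j + 1) = 3 * 3 ^ j := by ring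
  rw [threeWeightFrequency, e1, e2, e3, e4, p1, p2, p3, p4]
  have hP : 1 ≤ 3 ^ j := Nat.one_le_pow _ _ (by norm_num)
  have hPZ : ((3 ^ j : ℕ) : ℤ) = (3 : ℤ) ^ j := by push_cast; rfl
  have hPP : 3 ^ j ≤ (3 ^ j) ^ 2 := Nat.le_self_pow two_ne_zero _
  have hPPZ : (((3 ^ j) ^ 2 : ℕ) : ℤ) = ((3 : ℤ) ^ j) ^ 2 := by push_cast; rfl
  rw [← hPZ] at h1
  rw [← hPPZ] at h2 hq
  have hw' : ∀ x, x ≠ 0 → (traceWeight f x : ℤ) =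
      6 * ((3 ^ j) ^ 2 : ℕ) - 2 * τ x * (3 ^ j : ℕ) := by
    intro x hx; rw [hw x hx]; push_cast; ring
  clear hw e1 e2 e3 e4 p1 p2 p3 p4 hPZ hPPZ
  -- Only `1 ≤ P ≤ S` is needed about the powers from here on, so the weights and counts become
  -- linear arithmetic.
  generalize (3 ^ j) ^ 2 = S at *
  generalize 3 ^ j = P at *
  have hval : ∀ x, x ≠ 0 → (τ x = 0 ∧ traceWeight f x = 6 * S) ∨
      (τ x = 1 ∧ traceWeight f x = 6 * S - 2 * P) ∨
      (τ x = -1 ∧ traceWeight f x = 6 * S + 2 * P) := by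
    intro x hx
    have := hw' x hx
    rcases hτ x with h | h | h <;> rw [h] at this
    · exact Or.inl ⟨h, by omega⟩
    · exact Or.inr (Or.inl ⟨h, by omega⟩)
    · exact Or.inr (Or.inr ⟨h, by omega⟩)
  -- Pointwise, `τ + τ²` is twice the indicator of `τ = 1`; likewise `τ² - τ` for -1 and `1 - τ²`
  -- for 0.
  have hplus : 2 * ((Finset.univ.filter fun x : F => τ x = 1).card : ℤ) = 18 * S + 6 * P := by
    rw [← h1, ← h2, Finset.card_filter, ← Finset.sum_add_distrib]
    push_cast
    rw [Finset.mul_sum]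
    refine Finset.sum_congr rfl fun x _ => ?_
    rcases hτ x with h | h | h <;> rw [h] <;> norm_num
  have hminus : 2 * ((Finset.univ.filter fun x : F => τ x = -1).card : ℤ) = 18 * S - 6 * P := by
    rw [← h1, ← h2, Finset.card_filter, ← Finset.sum_sub_distrib]
    push_cast
    rw [Finset.mul_sum]
    refine Finset.sum_congr rfl fun x _ => ?_
    rcases hτ x with h | h | h <;> rw [h] <;> norm_num
  have hzero : ((Finset.univ.filter fun x : F => τ x = 0).card : ℤ) = 27 * S - 18 * S := by
    rw [← hq, ← h2, Finset.card_filter, ← Finset.card_univ, Finset.card_eq_sum_ones]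
    push_cast
    rw [← Finset.sum_sub_distrib]
    refine Finset.sum_congr rfl fun x _ => ?_
    rcases hτ x with h | h | h <;> rw [h] <;> norm_num
  have hfilter : ∀ t : ℤ, t ≠ 0 → (∀ x, x ≠ 0 → (traceWeight f x = w ↔ τ x = t)) → w ≠ 0 →
      (Finset.univ.filter fun x : F => traceWeight f x = w).card =
        (Finset.univ.filter fun x : F => τ x = t).card := by
    intro t ht h hw
    congr 1
    ext x
    by_cases hx : x = 0
    · simp [hx, hw0, h0, hw.symm, ht.symm]
    · simp [h x hx]
  split_ifs with c0 c1 c2 c3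
  · rw [Finset.card_eq_one]
    refine ⟨0, ?_⟩
    ext x
    by_cases hx : x = 0
    · simp [hx, hw0, c0]
    · simp [hx, c0, (hpos x hx).ne']
  · rw [hfilter 1 (by norm_num) (fun x hx => ?_) c0]
    · omega
    · have := hval x hx; omega
  · rw [hfilter (-1) (by norm_num) (fun x hx => ?_) c0]
    · omega
    · have := hval x hx; omega
  -- The point 0 has `τ 0 = 0` by convention but weight 0, hence the `- 1` in this frequency.
  · have : (Finset.univ.filter fun x : F => traceWeight f x = w) =
        (Finset.univ.filter fun x : F => τ x = 0).erase 0 := by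
      ext x
      by_cases hx : x = 0
      · simp [hx, hw0, Ne.symm c0]
      · have h : traceWeight f x = w ↔ τ x = 0 := by
          have := hval x hx; omega
        simp [hx, h]
    rw [this, Finset.card_erase_of_mem (by simp [h0])]
    omega
  · rw [Finset.card_eq_zero, Finset.filter_eq_empty_iff]
    intro x _ hxw
    by_cases hx : x = 0
    · rw [hx, hw0] at hxw
      exact c0 hxw.symm
    · have := hval x hx; omega

end Count

end IsSquaringPair

/-! ### The trace code. -/

namespace IsSquaringPair

section Code

variable {F : Type*} [Field F] [Algebra (ZMod 3) F] [Fintype F]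

/-- The linear map sending `x` to the codeword `(Tr (β i * x))_i`. -/
noncomputable def traceCodeword {n : ℕ} (β : Fin n → F) : F →ₗ[ZMod 3] (Fin n → ZMod 3) where
  toFun x i := Algebra.trace (ZMod 3) F (β i * x)
  map_add' x y := by funext i; simp [mul_add]
  map_smul' r x := by funext i; simp

omit [Fintype F] in
theorem range_traceCodeword {n : ℕ} (β : Fin n → F) :
    LinearMap.range (traceCodeword β) = traceCode (ZMod 3) β := by
  ext c
  constructor
  · rintro ⟨x, rfl⟩
    exact ⟨x, rfl⟩
  · rintro ⟨x, rfl⟩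
    exact ⟨x, rfl⟩

theorem hammingNorm_traceCodeword {d n : ℕ} {β : Fin n → F} (hβ : Function.Injective β)
    (hrange : Set.range β = definingSet (ZMod 3) d 0) (x : F) :
    hammingNorm (traceCodeword β x) = traceWeight (fun b : F => b ^ d) x := by
  classical
  rw [hammingNorm, traceWeight, ← Finset.card_image_of_injective _ hβ]
  congr 1
  ext b
  have hb : b ∈ Set.range β ↔ b ≠ 0 ∧ Algebra.trace (ZMod 3) F (b ^ d) = 0 := by
    rw [hrange]; rfl
  simp only [Finset.mem_image, Finset.mem_filter, Finset.mem_univ, true_and, traceKernel]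
  constructor
  · rintro ⟨i, hi, rfl⟩
    exact ⟨(hb.1 ⟨i, rfl⟩).2, hi⟩
  · rintro ⟨h1, h2⟩
    -- The kernel contains 0 and the defining set does not, but 0 never contributes to a weight.
    obtain ⟨i, rfl⟩ := hb.2 ⟨by rintro rfl; simp at h2, h1⟩
    exact ⟨i, h2, rfl⟩

variable {σ : F ≃ₐ[ZMod 3] F} {d j : ℕ} (H : IsSquaringPair σ fun x : F => x ^ d)
  (hj : Module.finrank (ZMod 3) F = 2 * j + 3)

include H hj in
theorem ncard_definingSet :
    (definingSet (ZMod 3) d 0 : Set F).ncard = 3 ^ (2 * j + 2) - 1 := by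
  classical
  have h : (definingSet (ZMod 3) d 0 : Set F) =
      ((traceKernel fun x : F => x ^ d).erase 0 : Finset F) := by
    ext x
    simp [definingSet, traceKernel, and_comm]
  rw [h, Set.ncard_coe_finset, Finset.card_erase_of_mem H.zero_mem_traceKernel,
    H.card_traceKernel hj]
  congr 1
  ring

include H hj in
theorem traceCode_weights {n : ℕ} {β : Fin n → F} (hβ : Function.Injective β)
    (hrange : Set.range β = definingSet (ZMod 3) d 0) :
    Module.finrank (ZMod 3) (traceCode (ZMod 3) β) = 2 * j + 3 ∧
      ∀ w : ℕ, weightCount (traceCode (ZMod 3) β) w = threeWeightFrequency (2 * j + 3) 1 w := by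
  have hw := hammingNorm_traceCodeword hβ hrange
  have hinj : Function.Injective (traceCodeword β) := by
    refine (injective_iff_map_eq_zero _).2 fun x hx => ?_
    by_contra hne
    have := H.traceWeight_pos hj hne
    rw [← hw, hx, hammingNorm_zero] at this
    exact lt_irrefl _ this
  refine ⟨?_, fun w => ?_⟩
  · rw [← range_traceCodeword, LinearMap.finrank_range_of_inj hinj, hj]
  · rw [← H.card_traceWeight_eq hj, weightCount, ← Set.ncard_coe_finset,
      ← Set.ncard_image_of_injective _ hinj]
    congr 1
    ext c
    rw [← range_traceCodeword]
    constructor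
    · rintro ⟨⟨x, rfl⟩, hc⟩
      exact ⟨x, by simpa [← hw] using hc, rfl⟩
    · rintro ⟨x, hx, rfl⟩
      exact ⟨⟨x, rfl⟩, by simpa [← hw] using hx⟩

end Code

end IsSquaringPair

/-! ### Frobenius powers and the three exponents. -/

section Frobenius

variable {F : Type*} [Field F] [Fintype F] [Algebra (ZMod 3) F]

omit [Algebra (ZMod 3) F] in
theorem isSquare_or_isSquare_neg (h : ¬ IsSquare (-1 : F)) (x : F) :
    IsSquare x ∨ IsSquare (-x) := by
  classical
  by_cases hx : x = 0
  · exact Or.inl ⟨0, by simp [hx]⟩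
  by_contra! hne
  have h1 := quadraticChar_neg_one_iff_not_isSquare.2 hne.1
  have h2 := quadraticChar_neg_one_iff_not_isSquare.2 hne.2
  have h3 := quadraticChar_neg_one_iff_not_isSquare.2 h
  rw [← neg_one_mul, map_mul, h1, h3] at h2
  norm_num at h2

omit [Algebra (ZMod 3) F] in
-- Under cubing `x` has periods `k` and `m`, hence period 1, so `x ^ 3 = x`.
theorem pow_frobenius_fixed {m k : ℕ} (hF : Fintype.card F = 3 ^ m) (hk : Nat.gcd k m = 1) {x : F}
    (hx : x ^ 3 ^ k = x) : x = 0 ∨ x = 1 ∨ x = -1 := by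
  have h1 : Function.IsPeriodicPt (fun y : F => y ^ 3) k x := by
    rw [Function.IsPeriodicPt, pow_iterate]; exact hx
  have h2 : Function.IsPeriodicPt (fun y : F => y ^ 3) m x := by
    rw [Function.IsPeriodicPt, pow_iterate, ← hF]; exact FiniteField.pow_card x
  have h3 := h1.gcd h2
  rw [hk] at h3
  have h4 : x ^ 3 = x := h3
  have h5 : x * ((x - 1) * (x + 1)) = 0 := by linear_combination h4
  rcases mul_eq_zero.1 h5 with h | h
  · exact Or.inl h
  rcases mul_eq_zero.1 h with h | h
  · exact Or.inr (Or.inl (sub_eq_zero.1 h))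
  · exact Or.inr (Or.inr (eq_neg_of_add_eq_zero_left h))

omit [Algebra (ZMod 3) F] in
theorem pow_eq_sq_of_modEq {m n : ℕ} (hF : Fintype.card F = 3 ^ m) (hn : n ≡ 2 [MOD 3 ^ m - 1])
    (hn0 : n ≠ 0) (x : F) : x ^ n = x ^ 2 := by
  by_cases hx : x = 0
  · rw [hx, zero_pow hn0, zero_pow two_ne_zero]
  · exact pow_eq_pow_of_modEq hn (by rw [← hF]; exact FiniteField.pow_card_sub_one_eq_one x hx)

theorem isSquaringPair_frobenius_pow {m k d : ℕ} (hodd : Odd m) (hF : Fintype.card F = 3 ^ m)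
    (hk : Nat.gcd k m = 1) (hd : Even d) (hd0 : d ≠ 0)
    (hmod : d * (3 ^ k + 1) ≡ 2 [MOD 3 ^ m - 1]) :
    IsSquaringPair (FiniteField.frobeniusAlgEquivOfAlgebraic (ZMod 3) F ^ k)
      fun x : F => x ^ d := by
  have hσ : ∀ x : F, (FiniteField.frobeniusAlgEquivOfAlgebraic (ZMod 3) F ^ k) x = x ^ 3 ^ k := by
    intro x
    rw [AlgEquiv.coe_pow, FiniteField.coe_frobeniusAlgEquivOfAlgebraic_iterate, ZMod.card]
  have hsq : ¬ IsSquare (-1 : F) := by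
    rw [FiniteField.isSquare_neg_one_iff, hF, not_not]
    obtain ⟨t, rfl⟩ := hodd
    rw [pow_succ, pow_mul, Nat.mul_mod, Nat.pow_mod]
    simp
  have hpow := pow_eq_sq_of_modEq (F := F) hF hmod (by positivity)
  refine ⟨fun x hx => ?_, hsq, isSquare_or_isSquare_neg hsq, fun x y => mul_pow x y d,
    fun x => hd.neg_pow x, fun x => ?_, fun x => ?_⟩
  · rw [hσ] at hx
    exact pow_frobenius_fixed hF hk hx
  · rw [hσ, ← hpow]; ring
  · rw [hσ, ← hpow]; ring

end Frobenius

/-- With `q = 3 ^ m`, the left side is the common value of `d * (3 ^ k + 1)` for all three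
exponents. -/
theorem three_mul_sub_one_modEq {q : ℕ} (hq : 1 ≤ q) : 3 * q - 1 ≡ 2 [MOD q - 1] := by
  obtain ⟨t, rfl⟩ := Nat.exists_eq_add_of_le' hq
  rw [show 3 * (t + 1) - 1 = 2 + t * 3 by omega, Nat.add_sub_cancel]
  exact Nat.add_mul_mod_self_left 2 t 3

theorem even_three_pow_sub_one (n : ℕ) : Even (3 ^ n - 1) := by
  have h : Odd (3 ^ n) := Odd.pow (by decide)
  exact Nat.Odd.sub_odd h odd_one

theorem three_pow_sub_one_mul_add_one (n : ℕ) : (3 ^ n - 1) * (3 ^ n + 1) = 3 ^ (2 * n) - 1 := by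
  rw [mul_comm, ← Nat.sq_sub_sq, ← pow_mul, one_pow, mul_comm n 2]

/-- Each of the three exponents admits a parameter `k` prime to `m`. -/
theorem exists_frobenius_exponent {m d : ℕ} (hodd : Odd m)
    (hd : d = (3 ^ m + 1) / 4 + (3 ^ m - 1) / 2 ∨
      d = 3 ^ ((m + 1) / 2) - 1 ∨
      (m ≡ 3 [MOD 4] ∧ d = (3 ^ ((m + 1) / 4) - 1) * (3 ^ ((m + 1) / 2) + 1))) :
    ∃ k, 0 < k ∧ Nat.gcd k m = 1 ∧ Even d ∧ d ≠ 0 ∧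
      d * (3 ^ k + 1) ≡ 2 [MOD 3 ^ m - 1] := by
  have hq : 1 ≤ 3 ^ m := Nat.one_le_pow _ _ (by norm_num)
  rcases hd with rfl | rfl | ⟨hm, rfl⟩
  · obtain ⟨t, rfl⟩ := hodd
    -- Modulo 8 is needed for parity: `(q + 1) / 4` and `(q - 1) / 2` are both odd, so `d` is even.
    have h8 : 3 ^ (2 * t + 1) % 8 = 3 := by
      rw [pow_succ, pow_mul, Nat.mul_mod, Nat.pow_mod]
      simp
    have h := three_mul_sub_one_modEq hq
    generalize 3 ^ (2 * t + 1) = q at *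
    refine ⟨1, one_pos, Nat.gcd_one_left _, ?_, ?_, ?_⟩
    · rw [Nat.even_iff]; omega
    · omega
    · rwa [show ((q + 1) / 4 + (q - 1) / 2) * (3 ^ 1 + 1) = 3 * q - 1 by omega]
  · obtain ⟨t, rfl⟩ := hodd
    rw [show (2 * t + 1 + 1) / 2 = t + 1 by omega]
    refine ⟨t + 1, Nat.succ_pos t, ?_, even_three_pow_sub_one _, ?_, ?_⟩
    · rw [show 2 * t + 1 = t + (t + 1) by ring]
      simp
    · have : 3 ≤ 3 ^ (t + 1) := Nat.le_self_pow (Nat.succ_ne_zero t) 3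
      omega
    · rw [three_pow_sub_one_mul_add_one, show 2 * (t + 1) = 2 * t + 1 + 1 by ring,
        pow_succ' 3 (2 * t + 1)]
      exact three_mul_sub_one_modEq hq
  · obtain ⟨t, rfl⟩ : ∃ t, m = 4 * t + 3 := ⟨m / 4, by
      have : m % 4 = 3 := hm
      omega⟩
    rw [show (4 * t + 3 + 1) / 2 = 2 * (t + 1) by omega, show (4 * t + 3 + 1) / 4 = t + 1 by omega]
    refine ⟨t + 1, Nat.succ_pos t, ?_, (even_three_pow_sub_one _).mul_right _, ?_, ?_⟩
    · rw [show 4 * t + 3 = 3 * (t + 1) + t by ring]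
      simp
    · have : 3 ≤ 3 ^ (t + 1) := Nat.le_self_pow (Nat.succ_ne_zero t) 3
      exact mul_ne_zero (by omega) (Nat.succ_ne_zero _)
    · rw [mul_right_comm, three_pow_sub_one_mul_add_one, three_pow_sub_one_mul_add_one,
        show 2 * (2 * (t + 1)) = 4 * t + 3 + 1 by ring, pow_succ' 3 (4 * t + 3)]
      exact three_mul_sub_one_modEq hq

theorem corollary2 {F : Type*} [Field F] [Fintype F] [Algebra (ZMod 3) F] (m d : ℕ)
    (hm : 3 ≤ m) (hodd : Odd m) (hF : Fintype.card F = 3 ^ m)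
    (hd : d = (3 ^ m + 1) / 4 + (3 ^ m - 1) / 2 ∨
      d = 3 ^ ((m + 1) / 2) - 1 ∨
      (m ≡ 3 [MOD 4] ∧ d = (3 ^ ((m + 1) / 4) - 1) * (3 ^ ((m + 1) / 2) + 1))) :
    IsAPN (fun x : F => x ^ d) ∧
    ∃ k : ℕ, 0 < k ∧ 3 ≤ m / Nat.gcd k m ∧ Odd (m / Nat.gcd k m) ∧
      d * (3 ^ k + 1) ≡ 2 [MOD 3 ^ m - 1] ∧
      (definingSet (ZMod 3) d 0 : Set F).ncard = 3 ^ (m - 1) - 1 ∧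
      ∀ β : Fin (3 ^ (m - 1) - 1) → F, Function.Injective β →
        Set.range β = definingSet (ZMod 3) d 0 →
        Module.finrank (ZMod 3) (traceCode (ZMod 3) β) = m ∧
        ∀ w : ℕ, weightCount (traceCode (ZMod 3) β) w =
          threeWeightFrequency m (Nat.gcd k m) w := by
  classical
  obtain ⟨k, hk0, hk, heven, hd0, hmod⟩ := exists_frobenius_exponent hodd hd
  have H := isSquaringPair_frobenius_pow hodd hF hk heven hd0 hmod
  -- An element outside the prime field seeds the pair of solutions showing that the bound 2 is
  -- attained.
  obtain ⟨r, -, hr⟩ : ∃ r ∈ (Finset.univ : Finset F), r ∉ ({0, 1, -1} : Finset F) := by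
    refine Finset.exists_mem_notMem_of_card_lt_card (Finset.card_le_three.trans_lt ?_)
    rw [Finset.card_univ, hF]
    exact lt_of_lt_of_le (by norm_num) (Nat.pow_le_pow_right (by norm_num) hm)
  simp only [Finset.mem_insert, Finset.mem_singleton, not_or] at hr
  refine ⟨H.isAPN hr.1 hr.2.1 hr.2.2, k, hk0, ?_⟩
  rw [hk, Nat.div_one]
  have hfin : Module.finrank (ZMod 3) F = m := by
    have h := Module.card_eq_pow_finrank (K := ZMod 3) (V := F)
    rw [hF, ZMod.card] at h
    exact (Nat.pow_right_injective (by norm_num : 2 ≤ 3) h).symm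
  obtain ⟨j, rfl⟩ : ∃ j, m = 2 * j + 3 := by
    obtain ⟨t, rfl⟩ := hodd
    exact ⟨t - 1, by omega⟩
  exact ⟨hm, hodd, hmod, H.ncard_definingSet hfin,
    fun β hβ hrange => H.traceCode_weights hfin hβ hrange⟩
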